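/- **Setting.** There are $C$ identical machines and $n\ge 1$ tasks $T_1,\dots,T_n$. Task $T_i$ has a value $v_i\ge 0$, a workload $D_i\in\mathbb Z^+$, a deadline $d_i\in\mathbb Z^+$ and a parallelism bound $k_i\in\mathbb Z^+$ with $k_i\le C$. Time consists of slots $1,2,\dots$. A feasible schedule of a set $S$ of tasks assigns to each $T_i\in S$ and each slot $t\in\{1,\dots,d_i\}$ a number $y_i(t)\in\{0,\dots,k_i\}$ of machines such that $\sum_{t\le d_i}y_i(t)\ge D_i$ for all $T_i\in S$ and $W(t)=\sum_i y_i(t)\le C$ for all $t$ (with $y_i(t)=0$ for $T_i\notin S$ and for $t\notin\{1,\dots,d_i\}$). The optimal social welfare $\mathrm{OPT}$ is the maximum of $\sum_{T_i\in S}v_i$ over the sets $S$ that have a feasible schedule. Let $len_i=\lceil D_i/k_i\rceil$, let $s_i=d_i/len_i$ be the slackness of $T_i$, assume $s_i\ge 1$ for all $i$, and let $s=\min_i s_i$. Write $\overline W(t)=C-W(t)$. **GreedyRLM.** Start with $y\equiv 0$ and threshold $\tau=0$, and consider the tasks one by one in an order of non-increasing marginal values $v_i/D_i$ (sorted by the algorithm).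 If $\sum_{t\le d_i}\min\{\overline W(t),k_i\}\ge D_i$, accept $T_i$ and call Allocate-A($i$); otherwise reject $T_i$. Whenever a maximal run of consecutive rejections ends, let $c$ and $c'$ be the largest deadlines of the tasks rejected and accepted so far; set $\tau=c$ if $c\ge c'$, and otherwise set $\tau=t-1$ for the first slot $t\in(c,c']$ with $\overline W(t)>0$, or $\tau=c'$ if there is no such $t$. Allocate-A($i$): first, for $t=d_i,\dots,1$, set $y_i(t)=\min\{k_i,\;D_i-\sum_{u=t+1}^{d_i}y_i(u),\;\overline W(t)\}$. Then, for $t=d_i,d_i-1,\dots$, as long as $\sum_{u<t}y_i(u)>0$, let $\Delta=\min\{k_i-y_i(t),\sum_{u<t}y_i(u)\}$ and, if $\Delta>0$, do the following. (a) While $\overline W(t)<\Delta$: let $t'$ be the last slot before $t$ with $\overline W(t')>0$; leave this loop if $t'$ does not exist, if $t'\le\tau$, or if $\sum_{u<t'}y_i(u)\le\overline W(t)$; otherwise choose any task $T_j$ with $y_j(t)>y_j(t')$, decrease $y_j(t)$ by $1$ and increase $y_j(t')$ by $1$. (b) Let $\theta=\overline W(t)$, increase $y_i(t)$ by $\theta$,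 and decrease the allocation of $T_i$ by $\theta$ in total at its earliest slots. **Proposition.** However the choices of $T_j$ are made, GreedyRLM outputs a set $\mathcal A$ of accepted tasks together with a feasible schedule of $\mathcal A$, and $$\sum_{T_i\in\mathcal A}v_i\;\ge\;\frac{s-1}{s}\,\mathrm{OPT}.$$ Moreover, if the deadlines and the parallelism bounds are bounded by constants, GreedyRLM takes $O(n^2)$ time: for all $\bar d,\bar k$ there is a constant $c=c(\bar d,\bar k)$ such that on every instance with $d_i\le\bar d$ and $k_i\le\bar k$ for all $i$ (with any $n$, any number $C$ of machines, any values) it takes at most $c\,n^2$ elementary steps (reading or writing a table entry, an arithmetic operation or a comparison). -/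

import Mathlib

/-! ### Malleable tasks with deadlines on identical machines -/

namespace Malleable

/-- A malleable batch task: value `v`, workload `D`, deadline `d`, parallelism bound `k`. -/
structure Task where
  v : ℝ
  D : ℕ
  d : ℕ
  k : ℕ

/-- An instance: `C` identical machines and tasks `T_i`, `i : Fin n`. -/
structure Inst (n : ℕ) where
  C : ℕ
  T : Fin n → Task

/-- An allocation table: `y i t` is the number of machines given to task `i` in time slot `t`
(the time slots are `1, 2, …`). -/
abbrev Alloc (n : ℕ) := Fin n → ℕ → ℕ

namespace Inst

variable {n : ℕ}

/-- The minimal execution time `len_i = ⌈D_i / k_i⌉`. -/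
noncomputable def len (I : Inst n) (i : Fin n) : ℕ := ⌈((I.T i).D : ℝ) / (I.T i).k⌉₊

/-- The slackness `s_i = d_i / len_i`. -/
noncomputable def slackness (I : Inst n) (i : Fin n) : ℝ := ((I.T i).d : ℝ) / I.len i

/-- The minimum slackness `s` (of a nonempty finite family of tasks). -/
noncomputable def minSlackness (I : Inst n) : ℝ := ⨅ i, I.slackness i

/-- The marginal value `v_i / D_i`. -/
noncomputable def marginal (I : Inst n) (i : Fin n) : ℝ := (I.T i).v / (I.T i).D

/-- The standing conventions of the model: workloads, deadlines and parallelism bounds are positive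
integers, values are nonnegative, no task may use more machines than there are, and every
slackness is at least `1`. -/
structure Valid (I : Inst n) : Prop where
  v_nonneg : ∀ i, 0 ≤ (I.T i).v
  D_pos : ∀ i, 0 < (I.T i).D
  d_pos : ∀ i, 0 < (I.T i).d
  k_pos : ∀ i, 0 < (I.T i).k
  k_le : ∀ i, (I.T i).k ≤ I.C
  one_le_slackness : ∀ i, 1 ≤ I.slackness i

/-- `y` is a feasible schedule of the set `S` of tasks on `C` machines. -/
structure Feasible (I : Inst n) (S : Finset (Fin n)) (y : Alloc n) : Prop where
  support : ∀ i t, i ∉ S ∨ t = 0 ∨ (I.T i).d < t → y i t = 0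
  parallelism : ∀ i t, y i t ≤ (I.T i).k
  capacity : ∀ t, ∑ i, y i t ≤ I.C
  completed : ∀ i ∈ S, (I.T i).D ≤ ∑ t ∈ Finset.Icc 1 (I.T i).d, y i t

/-- The social welfare of completing the tasks in `S`. -/
noncomputable def welfare (I : Inst n) (S : Finset (Fin n)) : ℝ := ∑ i ∈ S, (I.T i).v

/-- The optimal social welfare: the largest welfare of a set that has a feasible schedule (there
are finitely many such sets, and `∅` is one of them). -/
noncomputable def optWelfare (I : Inst n) : ℝ :=
  sSup {w | ∃ S y, I.Feasible S y ∧ w = I.welfare S}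

end Inst

/-! ### Counting elementary steps -/

/-- A result together with the number of elementary steps spent on computing it. -/
structure Timed (α : Type) where
  val : α
  steps : ℕ

/-- Steps add up under sequential composition; only `step` spends any. -/
instance : Monad Timed where
  pure a := ⟨a, 0⟩
  bind x f := ⟨(f x.val).val, x.steps + (f x.val).steps⟩

/-- One elementary operation (reading or writing one number, one arithmetic operation, one
comparison, one operation at the head of a list) with result `a`. The algorithms below perform
such operations only inside `step` (apart from advancing the counter of a loop, where every pass
contains a step). -/
def step {α : Type} (a : α) : Timed α := ⟨a, 1⟩

/-- Write `a` into the entry `(i, t)` of the table `y`. -/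
def write {n : ℕ} (y : Alloc n) (i : Fin n) (t a : ℕ) : Timed (Alloc n) :=
  step (Function.update y i (Function.update (y i) t a))

/-! ### The algorithm -/

section Algorithm

variable {n : ℕ}

/-- The sum of `y j t` over the tasks `j` of a list. -/
def sumTasks (y : Alloc n) (t : ℕ) : List (Fin n) → Timed ℕ
  | [] => step 0
  | j :: l => do
    let a ← step (y j t)
    let b ← sumTasks y t l
    step (a + b)

/-- The number `C - W(t)` of machines available in slot `t`. -/
def avail (I : Inst n) (y : Alloc n) (t : ℕ) : Timed ℕ := do
  let w ← sumTasks y t (List.finRange n)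
  step (I.C - w)

/-- The total allocation of task `i` in the slots `1, …, t`. -/
def prefixSum (y : Alloc n) (i : Fin n) : ℕ → Timed ℕ
  | 0 => step 0
  | t + 1 => do
    let a ← prefixSum y i t
    let b ← step (y i (t + 1))
    step (a + b)

/-- The sum over the slots `1, …, t` of `min (C - W(t)) k_i`. -/
def usable (I : Inst n) (y : Alloc n) (i : Fin n) : ℕ → Timed ℕ
  | 0 => step 0
  | t + 1 => do
    let a ← usable I y i t
    let w ← avail I y (t + 1)
    let k ← step (I.T i).k
    let b ← step (min w k)
    step (a + b)

/-- The allocation condition for task `i`. -/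
def allocatable (I : Inst n) (y : Alloc n) (i : Fin n) : Timed Bool := do
  let d ← step (I.T i).d
  let a ← usable I y i d
  let D ← step (I.T i).D
  step (decide (D ≤ a))

/-- `Fully-Utilize`: for `t` downwards to `1`, give task `i` as many machines as are possible and
needed, where `rem` is the part of its demand that is not allocated yet. -/
def fullyUtilize (I : Inst n) (i : Fin n) : ℕ → ℕ → Alloc n → Timed (Alloc n)
  | 0, _, y => pure y
  | t + 1, rem, y => do
    let w ← avail I y (t + 1)
    let k ← step (I.T i).k
    let b ← step (min rem w)
    let a ← step (min k b)
    let y' ← write y i (t + 1) a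
    let rem' ← step (rem - a)
    fullyUtilize I i t rem' y'

/-- The last of the slots `1, …, t` with an available machine. -/
def lastFree (I : Inst n) (y : Alloc n) : ℕ → Timed (Option ℕ)
  | 0 => pure none
  | t + 1 => do
    let w ← avail I y (t + 1)
    if ← step (decide (0 < w)) then
      pure (some (t + 1))
    else
      lastFree I y t

/-- The first task `j` of the list with `y j t > y j t'`. -/
def findTask (y : Alloc n) (t t' : ℕ) : List (Fin n) → Timed (Option (Fin n))
  | [] => pure none
  | j :: l => do
    let a ← step (y j t)
    let b ← step (y j t')
    if ← step (decide (b < a)) then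
      pure (some j)
    else
      findTask y t t' l

/-- How the choice of "a task `j` with `y j t > y j t'`" is resolved: the tasks are searched in the
order `ρ y t t'`. As `ρ` is arbitrary, so is the chosen task. -/
abbrev SearchOrder (n : ℕ) := Alloc n → ℕ → ℕ → Equiv.Perm (Fin n)

/-- `Routine(Δ, 0, 1)` at slot `t`, on behalf of task `i`, with current threshold `th`. The
number that follows `Δ` bounds the passes of the loop; a pass that does not leave the loop frees
one machine in slot `t`, so that `Δ` passes suffice. -/
def routine (I : Inst n) (ρ : SearchOrder n) (i : Fin n) (th t Δ : ℕ) :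
    ℕ → Alloc n → Timed (Alloc n)
  | 0, y => pure y
  | m + 1, y => do
    let w ← avail I y t
    if ← step (decide (w < Δ)) then
      let t₁ ← step (t - 1)
      match ← lastFree I y t₁ with
      | none => pure y
      | some t' =>
        if ← step (decide (t' ≤ th)) then
          pure y
        else
          let t₂ ← step (t' - 1)
          let p ← prefixSum y i t₂
          if ← step (decide (p ≤ w)) then
            pure y
          else
            match ← findTask y t t' ((List.finRange n).map (ρ y t t')) with
            | none => pure y
            | some j =>
              let a ← step (y j t)
              let a' ← step (a - 1)
              let y₁ ← write y j t a'
              let b ← step (y₁ j t')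
              let b' ← step (b + 1)
              let y₂ ← write y₁ j t' b'
              routine I ρ i th t Δ m y₂
    else
      pure y

/-- Take `r` machine-slots away from task `i`, from its earliest allocations on, going through the
slots `u, u + 1, …` (at most `m` of them). -/
def drain (i : Fin n) : ℕ → ℕ → ℕ → Alloc n → Timed (Alloc n)
  | 0, _, _, y => pure y
  | m + 1, u, r, y => do
    let a ← step (y i u)
    if ← step (decide (a < r)) then
      let y' ← write y i u 0
      let r' ← step (r - a)
      let u' ← step (u + 1)
      drain i m u' r' y'
    else
      let a' ← step (a - r)
      write y i u a'

/-- `AllocateRLM(i, 0)` from slot `t` downwards, with current threshold `th`: transfer the earliest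
allocations of task `i` to slot `t`, as far as `Routine` can make machines available there. -/
def allocateRLM (I : Inst n) (ρ : SearchOrder n) (i : Fin n) (th : ℕ) :
    ℕ → Alloc n → Timed (Alloc n)
  | 0, y => pure y
  | t + 1, y => do
    let p ← prefixSum y i t
    if ← step (decide (0 < p)) then
      let k ← step (I.T i).k
      let a ← step (y i (t + 1))
      let b ← step (k - a)
      let Δ ← step (min b p)
      if ← step (decide (0 < Δ)) then
        let y₁ ← routine I ρ i th (t + 1) Δ Δ y
        let θ ← avail I y₁ (t + 1)
        let a₁ ← step (y₁ i (t + 1))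
        let a₂ ← step (a₁ + θ)
        let y₂ ← write y₁ i (t + 1) a₂
        let y₃ ← drain i t 1 θ y₂
        allocateRLM I ρ i th t y₃
      else
        allocateRLM I ρ i th t y
    else
      pure y

/-- `Allocate-A(i)`. -/
def allocateA (I : Inst n) (ρ : SearchOrder n) (i : Fin n) (th : ℕ) (y : Alloc n) :
    Timed (Alloc n) := do
  let d ← step (I.T i).d
  let D ← step (I.T i).D
  let y' ← fullyUtilize I i d D y
  allocateRLM I ρ i th d y'

/-- Starting from `c`, go forward through full slots, at most `m` of them, and stop just before the
first slot that has an available machine. -/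
def scanFull (I : Inst n) (y : Alloc n) : ℕ → ℕ → Timed ℕ
  | 0, c => pure c
  | m + 1, c => do
    let c₁ ← step (c + 1)
    let w ← avail I y c₁
    if ← step (decide (0 < w)) then
      pure c
    else
      scanFull I y m c₁

/-- The threshold of a phase: `c` if `c ≥ c'`; otherwise the slot just before the first slot in
`(c, c']` that has an available machine, or `c'` if there is no such slot. -/
def threshold (I : Inst n) (y : Alloc n) (c c' : ℕ) : Timed ℕ := do
  if ← step (decide (c' ≤ c)) then
    pure c
  else
    let m ← step (c' - c)
    scanFull I y m c

/-- Variables of the greedy algorithm: the allocation, the accepted tasks, the threshold of the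
last completed phase (`0` before that), the largest deadline `c` of a rejected task and the largest
deadline `c'` of an accepted task. -/
structure GState (n : ℕ) where
  y : Alloc n
  accepted : Finset (Fin n)
  th : ℕ
  c : ℕ
  c' : ℕ

/-- A run of rejected tasks, hence a phase, ends when no task is left or the next one satisfies the
allocation condition. -/
def endOfPhase (I : Inst n) (y : Alloc n) : List (Fin n) → Timed Bool
  | [] => step true
  | j :: _ => allocatable I y j

/-- The main loop, over the tasks in the given order. -/
def greedyLoop (I : Inst n) (ρ : SearchOrder n) : List (Fin n) → GState n → Timed (GState n)
  | [], g => pure g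
  | i :: l, g => do
    if ← allocatable I g.y i then
      let y ← allocateA I ρ i g.th g.y
      let acc ← step (insert i g.accepted)
      let d ← step (I.T i).d
      let c' ← step (max g.c' d)
      greedyLoop I ρ l { g with y := y, accepted := acc, c' := c' }
    else
      let d ← step (I.T i).d
      let c ← step (max g.c d)
      if ← endOfPhase I g.y l then
        let th ← threshold I g.y c g.c'
        greedyLoop I ρ l { g with th := th, c := c }
      else
        greedyLoop I ρ l { g with c := c }

open scoped Classical in
/-- Insert task `i` into a list that is sorted by non-increasing marginal values. -/
noncomputable def insertTask (I : Inst n) (i : Fin n) : List (Fin n) → Timed (List (Fin n))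
  | [] => step [i]
  | j :: l => do
    let a ← step (I.marginal i)
    let b ← step (I.marginal j)
    if ← step (decide (b ≤ a)) then
      step (i :: j :: l)
    else
      let l' ← insertTask I i l
      step (j :: l')

/-- Sort a list of tasks by non-increasing marginal values. -/
noncomputable def sortTasks (I : Inst n) : List (Fin n) → Timed (List (Fin n))
  | [] => step []
  | i :: l => do
    let l' ← sortTasks I l
    insertTask I i l'

/-- The empty allocation; one step for each entry `(i, t)` with `1 ≤ t ≤ d_i`. -/
def initAlloc (I : Inst n) : Timed (Alloc n) := ⟨fun _ _ => 0, ∑ i, (I.T i).d⟩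

/-- GreedyRLM. The output consists of the accepted tasks and the allocation table. -/
noncomputable def greedyRLM (I : Inst n) (ρ : SearchOrder n) :
    Timed (Finset (Fin n) × Alloc n) := do
  let y ← initAlloc I
  let l ← sortTasks I (List.finRange n)
  let g ← greedyLoop I ρ l { y := y, accepted := ∅, th := 0, c := 0, c' := 0 }
  pure (g.accepted, g.y)

end Algorithm

end Malleable

/-!
**Approximation.** Write `r = (s - 1) / s` and let `P` be the set of tasks considered so far and `A`
the accepted ones among them. It suffices that at every stage `r` times the workload of `S ∩ P` is
at most the workload of `A`, for every set `S` with a feasible schedule: as the tasks come in the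
order of non-increasing marginal values, Abel summation (`value_step`) turns these inequalities
into `r * welfare S ≤ welfare A`.

Accepting a task preserves the inequality since `r ≤ 1`. When a task is rejected, let `τ` be the
threshold computed from the largest deadlines of the tasks rejected and accepted so far. Then
`workload_le` gives the inequality from three facts.
* Rejected tasks have deadlines at most `τ`, so `S` has to process them in the slots `1, …, τ`.
* At least the fraction `r` of these slots is busy. Indeed, when task `i` with slackness `s_i` is
  rejected, the available machines up to its deadline amount to at most `len_i` empty slots
  (`load_of_not_allocatable`), which is the fraction `1 / s_i`, and the slots between the largest
  deadline of a rejected task and `τ` are full. Later on, the total load of a slot up to the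
  threshold never decreases.
* In the slots after `τ` every accepted task processes as much as any schedule can process there.

By the choice of `τ`, either no accepted task has a deadline after `τ` or a machine is available in
slot `τ + 1`. In the second case the third fact is an invariant (`LoopInv.packed`), which rests on
the analysis of `AllocateRLM` for the new task `i`. Call a slot free if not all of its machines are
in use. The last free slot before the current one, from which `Routine` obtains machines, moves only
towards the past: `Routine` stops before the machines gained would outnumber what task `i` uses
before that slot, so that removing the earliest allocations of task `i` creates free slots only
before it (`RoutineSpec.guard`, `RoutineSpec.cross`). Consequently no machine of another task is
ever moved across a slot that is free in the end (`RLMSpec.cross`), and every slot that is free in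
the end was free before (`RLMSpec.others`), so the old tasks keep the property. If task `i` still
uses slots before a free slot beyond the threshold, then in the slots from there on it uses its full
parallelism (`RLMSpec.shape`), because otherwise `Routine` would have made more machines available:
as long as fewer than it asks for are available, some other task uses more machines in the current
slot than in the last free one (`routine_pass`).

**Running time.** Every access to the loads costs `O(n)` steps. With bounded deadlines and
parallelism bounds, every loop over slots and every run of `Routine` has boundedly many passes, so
that a task costs `O(n)` steps; insertion sort costs `O(n²)`.
-/

namespace Malleable

open Finset

variable {n : ℕ}

/-! ### Timed computations and allocation tables -/

@[simp] theorem val_bind {α β : Type} (x : Timed α) (f : α → Timed β) :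
    (x >>= f).val = (f x.val).val := rfl

@[simp] theorem steps_bind {α β : Type} (x : Timed α) (f : α → Timed β) :
    (x >>= f).steps = x.steps + (f x.val).steps := rfl

@[simp] theorem val_pure {α : Type} (a : α) : (pure a : Timed α).val = a := rfl

@[simp] theorem steps_pure {α : Type} (a : α) : (pure a : Timed α).steps = 0 := rfl

@[simp] theorem val_step {α : Type} (a : α) : (step a).val = a := rfl

@[simp] theorem steps_step {α : Type} (a : α) : (step a).steps = 1 := rfl

/-- A branching on a comparison. Rewriting with it takes the place of simplifying the condition,
which fails because the `Decidable` instances in the unfolded algorithms mention `step`. -/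
theorem val_ite_step {α : Type} (p : Prop) [Decidable p] (a b : Timed α) :
    (if (step (decide p)).val = true then a else b).val = if p then a.val else b.val := by
  by_cases h : p <;> simp [h]

/-- The number `W(t)` of machines that are busy in slot `t`. -/
def load (y : Alloc n) (t : ℕ) : ℕ := ∑ j, y j t

/-- The machine-slots that task `i` receives in the slots `1, …, t`. -/
def cumul (y : Alloc n) (i : Fin n) (t : ℕ) : ℕ := ∑ u ∈ Icc 1 t, y i u

/-- The table `y` with the entry `(i, t)` replaced by `a`. -/
def setEntry (y : Alloc n) (i : Fin n) (t a : ℕ) : Alloc n :=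
  Function.update y i (Function.update (y i) t a)

@[simp] theorem val_write (y : Alloc n) (i : Fin n) (t a : ℕ) :
    (write y i t a).val = setEntry y i t a := rfl

@[simp] theorem steps_write (y : Alloc n) (i : Fin n) (t a : ℕ) : (write y i t a).steps = 1 := rfl

@[simp] theorem setEntry_self (y : Alloc n) (i : Fin n) (t a : ℕ) : setEntry y i t a i t = a := by
  simp [setEntry]

theorem setEntry_of_task_ne (y : Alloc n) {i j : Fin n} (h : j ≠ i) (t a u : ℕ) :
    setEntry y i t a j u = y j u := by
  simp [setEntry, h]

theorem setEntry_of_slot_ne (y : Alloc n) (i j : Fin n) {t u : ℕ} (h : u ≠ t) (a : ℕ) :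
    setEntry y i t a j u = y j u := by
  by_cases hj : j = i
  · subst hj; simp [setEntry, h]
  · exact setEntry_of_task_ne y hj t a u

theorem load_eq_add_erase (y : Alloc n) (i : Fin n) (t : ℕ) :
    load y t = y i t + ∑ j ∈ univ.erase i, y j t :=
  (add_sum_erase _ _ (mem_univ i)).symm

theorem load_congr {y z : Alloc n} {t : ℕ} (h : ∀ j, y j t = z j t) : load y t = load z t :=
  sum_congr rfl fun j _ => h j

theorem load_setEntry_of_ne (y : Alloc n) (i : Fin n) {t u : ℕ} (h : u ≠ t) (a : ℕ) :
    load (setEntry y i t a) u = load y u :=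
  load_congr fun j => setEntry_of_slot_ne y i j h a

theorem load_setEntry_self (y : Alloc n) (i : Fin n) (t a : ℕ) :
    load (setEntry y i t a) t + y i t = load y t + a := by
  rw [load_eq_add_erase _ i, load_eq_add_erase y i, setEntry_self,
    sum_congr rfl fun j hj => setEntry_of_task_ne y (ne_of_mem_erase hj) t a t]
  omega

/-- Changing only the allocation of task `i` changes the load by the same amount. -/
theorem load_add_eq {y z : Alloc n} {i : Fin n} {t : ℕ} (h : ∀ j, j ≠ i → z j t = y j t) :
    load z t + y i t = load y t + z i t := by
  rw [load_eq_add_erase z i, load_eq_add_erase y i,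
    sum_congr rfl fun j hj => h j (ne_of_mem_erase hj)]
  omega

@[simp] theorem cumul_zero (y : Alloc n) (i : Fin n) : cumul y i 0 = 0 := by simp [cumul]

theorem cumul_succ (y : Alloc n) (i : Fin n) (t : ℕ) :
    cumul y i (t + 1) = cumul y i t + y i (t + 1) :=
  sum_Icc_succ_top (by omega) _

theorem cumul_mono (y : Alloc n) (i : Fin n) {t u : ℕ} (h : t ≤ u) : cumul y i t ≤ cumul y i u :=
  sum_le_sum_of_subset (Icc_subset_Icc_right h)

theorem cumul_congr {y z : Alloc n} {i j : Fin n} {t : ℕ}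
    (h : ∀ u, 1 ≤ u → u ≤ t → y i u = z j u) : cumul y i t = cumul z j t :=
  sum_congr rfl fun u hu => h u (mem_Icc.1 hu).1 (mem_Icc.1 hu).2

theorem sum_cumul (y : Alloc n) (t : ℕ) : ∑ i, cumul y i t = ∑ u ∈ Icc 1 t, load y u :=
  sum_comm

theorem val_sumTasks (y : Alloc n) (t : ℕ) (l : List (Fin n)) :
    (sumTasks y t l).val = (l.map fun j => y j t).sum := by
  induction l with
  | nil => rfl
  | cons j l ih => simp [sumTasks, ih]

@[simp] theorem val_avail (I : Inst n) (y : Alloc n) (t : ℕ) :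
    (avail I y t).val = I.C - load y t := by
  simp [avail, val_sumTasks, load, Fin.sum_univ_def]

@[simp] theorem val_prefixSum (y : Alloc n) (i : Fin n) (t : ℕ) :
    (prefixSum y i t).val = cumul y i t := by
  induction t with
  | zero => rfl
  | succ t ih => simp [prefixSum, ih, cumul_succ]

theorem val_usable (I : Inst n) (y : Alloc n) (i : Fin n) (t : ℕ) :
    (usable I y i t).val = ∑ u ∈ Icc 1 t, min (I.C - load y u) (I.T i).k := by
  induction t with
  | zero => rfl
  | succ t ih => simp [usable, ih, sum_Icc_succ_top]

theorem val_allocatable (I : Inst n) (y : Alloc n) (i : Fin n) :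
    (allocatable I y i).val = true ↔
      (I.T i).D ≤ ∑ u ∈ Icc 1 (I.T i).d, min (I.C - load y u) (I.T i).k := by
  rw [← val_usable]
  exact decide_eq_true_iff

/-! ### The subroutines of Allocate-A -/

theorem val_lastFree_succ (I : Inst n) (y : Alloc n) (t : ℕ) :
    (lastFree I y (t + 1)).val =
      if 0 < I.C - load y (t + 1) then some (t + 1) else (lastFree I y t).val := by
  rw [← val_avail]
  exact val_ite_step _ _ _

theorem lastFree_eq_none (I : Inst n) (y : Alloc n) {t : ℕ} (h : (lastFree I y t).val = none) :
    ∀ u, 1 ≤ u → u ≤ t → I.C ≤ load y u := by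
  induction t with
  | zero => intro u h1 h2; omega
  | succ t ih =>
    rw [val_lastFree_succ] at h
    split_ifs at h with hw
    intro u h1 h2
    rcases Nat.lt_or_ge t u with h3 | h3
    · obtain rfl : u = t + 1 := by omega
      omega
    · exact ih h u h1 h3

theorem lastFree_eq_some (I : Inst n) (y : Alloc n) {t t' : ℕ}
    (h : (lastFree I y t).val = some t') :
    1 ≤ t' ∧ t' ≤ t ∧ load y t' < I.C ∧ ∀ u, t' < u → u ≤ t → I.C ≤ load y u := by
  induction t with
  | zero => simp [lastFree] at h
  | succ t ih =>
    rw [val_lastFree_succ] at h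
    split_ifs at h with hw
    · simp only [Option.some.injEq] at h
      subst h
      exact ⟨by omega, le_rfl, by omega, fun u h1 h2 => by omega⟩
    · obtain ⟨h1, h2, h3, h4⟩ := ih h
      refine ⟨h1, by omega, h3, fun u h5 h6 => ?_⟩
      rcases Nat.lt_or_ge t u with h7 | h7
      · obtain rfl : u = t + 1 := by omega
        omega
      · exact h4 u h5 h7

theorem val_findTask_cons (y : Alloc n) (t t' : ℕ) (j : Fin n) (l : List (Fin n)) :
    (findTask y t t' (j :: l)).val =
      if y j t' < y j t then some j else (findTask y t t' l).val :=
  val_ite_step _ _ _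

theorem findTask_eq_none (y : Alloc n) (t t' : ℕ) {l : List (Fin n)}
    (h : (findTask y t t' l).val = none) : ∀ j ∈ l, y j t ≤ y j t' := by
  induction l with
  | nil => simp
  | cons j l ih =>
    rw [val_findTask_cons] at h
    split_ifs at h with hw
    intro k hk
    rcases List.mem_cons.1 hk with rfl | hk
    · omega
    · exact ih h k hk

theorem findTask_eq_some (y : Alloc n) (t t' : ℕ) {l : List (Fin n)} {j : Fin n}
    (h : (findTask y t t' l).val = some j) : y j t' < y j t := by
  induction l with
  | nil => simp [findTask] at h
  | cons k l ih =>
    rw [val_findTask_cons] at h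
    split_ifs at h with hw
    · simp only [Option.some.injEq] at h
      subst h
      exact hw
    · exact ih h

theorem val_drain_succ (i : Fin n) (m u r : ℕ) (y : Alloc n) :
    (drain i (m + 1) u r y).val =
      if y i u < r then (drain i m (u + 1) (r - y i u) (setEntry y i u 0)).val
      else setEntry y i u (y i u - r) :=
  val_ite_step _ _ _

/-- A closed form of `drain`: slot `v` loses what is left of `r` once the slots `u, …, v - 1` have
been emptied. -/
theorem val_drain (i : Fin n) (m u r : ℕ) (y : Alloc n) (j : Fin n) (v : ℕ) :
    (drain i m u r y).val j v =
      if j = i ∧ u ≤ v ∧ v < u + m then y i v - (r - ∑ w ∈ Ico u v, y i w) else y j v := by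
  induction m generalizing u r y with
  | zero =>
    rw [if_neg (by omega)]
    rfl
  | succ m ih =>
    rw [val_drain_succ]
    split_ifs with h1 h2 h2
    · rw [ih]
      obtain ⟨rfl, h2, h3⟩ := h2
      rcases Nat.eq_or_lt_of_le h2 with rfl | h4
      · rw [if_neg (by omega)]
        simp
        omega
      · have h5 : ∑ w ∈ Ico (u + 1) v, setEntry y j u 0 j w = ∑ w ∈ Ico (u + 1) v, y j w :=
          sum_congr rfl fun w hw =>
            setEntry_of_slot_ne y j j (by have := mem_Ico.1 hw; omega) 0
        have h6 : ∑ w ∈ Ico u v, y j w = y j u + ∑ w ∈ Ico (u + 1) v, y j w :=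
          sum_eq_sum_Ico_succ_bot h4 _
        rw [if_pos ⟨rfl, by omega, by omega⟩, setEntry_of_slot_ne _ _ _ (by omega), h5, h6]
        omega
    · rw [ih]
      rw [if_neg (by omega)]
      by_cases hj : j = i
      · exact setEntry_of_slot_ne _ _ _ (by omega) _
      · exact setEntry_of_task_ne _ hj _ _ _
    · obtain ⟨rfl, h2, h3⟩ := h2
      rcases Nat.eq_or_lt_of_le h2 with rfl | h4
      · simp
      · rw [setEntry_of_slot_ne _ _ _ (by omega), sum_eq_sum_Ico_succ_bot h4]
        omega
    · by_cases hj : j = i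
      · exact setEntry_of_slot_ne _ _ _ (by omega) _
      · exact setEntry_of_task_ne _ hj _ _ _

theorem drain_of_ne {i j : Fin n} (h : j ≠ i) (m u r : ℕ) (y : Alloc n) (v : ℕ) :
    (drain i m u r y).val j v = y j v := by
  rw [val_drain, if_neg (by tauto)]

theorem drain_of_lt (i : Fin n) {m v : ℕ} (h : m < v) (r : ℕ) (y : Alloc n) (j : Fin n) :
    (drain i m 1 r y).val j v = y j v := by
  rw [val_drain, if_neg (by omega)]

theorem drain_zero (i : Fin n) (m r : ℕ) (y : Alloc n) (j : Fin n) :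
    (drain i m 1 r y).val j 0 = y j 0 := by
  rw [val_drain, if_neg (by omega)]

theorem drain_succ (i : Fin n) {m v : ℕ} (h : v < m) (r : ℕ) (y : Alloc n) :
    (drain i m 1 r y).val i (v + 1) = y i (v + 1) - (r - cumul y i v) := by
  rw [val_drain, if_pos ⟨rfl, by omega, by omega⟩]
  rfl

theorem cumul_drain (i : Fin n) {m v : ℕ} (h : v ≤ m) (r : ℕ) (y : Alloc n) :
    cumul (drain i m 1 r y).val i v = cumul y i v - r := by
  induction v with
  | zero => simp
  | succ v ih =>
    rw [cumul_succ, cumul_succ, ih (by omega), drain_succ i (by omega)]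
    omega

/-- Where machines are left over, task `i` uses its full parallelism, unless it is already
complete. -/
def Saturated (I : Inst n) (y : Alloc n) (i : Fin n) (t : ℕ) : Prop :=
  ∀ u, u < t → load y (u + 1) < I.C → y i (u + 1) = (I.T i).k ∨ cumul y i u = 0

theorem fullyUtilize_of_ne (I : Inst n) {i j : Fin n} (h : j ≠ i) (t rem : ℕ) (y : Alloc n)
    (u : ℕ) : (fullyUtilize I i t rem y).val j u = y j u := by
  induction t generalizing rem y with
  | zero => rfl
  | succ t ih => simp [fullyUtilize, ih, setEntry_of_task_ne _ h]

theorem fullyUtilize_of_lt (I : Inst n) (i j : Fin n) {t u : ℕ} (h : t < u) (rem : ℕ)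
    (y : Alloc n) : (fullyUtilize I i t rem y).val j u = y j u := by
  induction t generalizing rem y with
  | zero => rfl
  | succ t ih =>
    simp [fullyUtilize, ih (by omega : t < u), setEntry_of_slot_ne _ _ _ (by omega : u ≠ t + 1)]

theorem fullyUtilize_zero (I : Inst n) (i j : Fin n) (t rem : ℕ) (y : Alloc n) :
    (fullyUtilize I i t rem y).val j 0 = y j 0 := by
  induction t generalizing rem y with
  | zero => rfl
  | succ t ih => simp [fullyUtilize, ih, setEntry_of_slot_ne _ _ _ (by omega : 0 ≠ t + 1)]

theorem val_fullyUtilize_succ (I : Inst n) (i : Fin n) (t rem : ℕ) (y : Alloc n) :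
    (fullyUtilize I i (t + 1) rem y).val =
      (fullyUtilize I i t (rem - min (I.T i).k (min rem (I.C - load y (t + 1))))
        (setEntry y i (t + 1) (min (I.T i).k (min rem (I.C - load y (t + 1)))))).val := by
  rw [← val_avail]
  rfl

theorem fullyUtilize_spec (I : Inst n) (i : Fin n) (t rem : ℕ) (y : Alloc n)
    (h0 : ∀ u, u < t → y i (u + 1) = 0) (hcap : ∀ u, load y u ≤ I.C) :
    (∀ u, u < t → (fullyUtilize I i t rem y).val i (u + 1) ≤ (I.T i).k) ∧
    (∀ u, load (fullyUtilize I i t rem y).val u ≤ I.C) ∧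
    cumul (fullyUtilize I i t rem y).val i t
      = min rem (∑ u ∈ Icc 1 t, min (I.C - load y u) (I.T i).k) ∧
    Saturated I (fullyUtilize I i t rem y).val i t := by
  induction t generalizing rem y with
  | zero => exact ⟨by omega, hcap, by simp, fun u hu => by omega⟩
  | succ t ih =>
    rw [val_fullyUtilize_succ]
    set a := min (I.T i).k (min rem (I.C - load y (t + 1))) with ha
    set z := setEntry y i (t + 1) a with hz
    have hload : load z (t + 1) = load y (t + 1) + a := by
      have h1 := load_setEntry_self y i (t + 1) a
      have h2 := h0 t (by omega)
      rw [← hz] at h1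
      omega
    have hcap1 := hcap (t + 1)
    have hsum : ∑ u ∈ Icc 1 t, min (I.C - load z u) (I.T i).k
        = ∑ u ∈ Icc 1 t, min (I.C - load y u) (I.T i).k :=
      sum_congr rfl fun u hu => by
        rw [load_setEntry_of_ne y i (by have := mem_Icc.1 hu; omega)]
    obtain ⟨h1, h2, h3, h4⟩ := ih (rem - a) z
      (fun u hu => (setEntry_of_slot_ne y i i (by omega) a).trans (h0 u (by omega)))
      (fun u => by
        by_cases hu : u = t + 1
        · subst hu; omega
        · rw [load_setEntry_of_ne y i hu]; exact hcap u)
    set w := (fullyUtilize I i t (rem - a) z).val with hw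
    have hwt : ∀ j, w j (t + 1) = z j (t + 1) := fun j =>
      fullyUtilize_of_lt I i j (by omega) _ _
    have hwi : w i (t + 1) = a := by rw [hwt, hz, setEntry_self]
    have hwl : load w (t + 1) = load y (t + 1) + a := by rw [load_congr hwt, hload]
    refine ⟨fun u hu => ?_, h2, ?_, fun u hu hfree => ?_⟩
    · rcases Nat.lt_or_ge u t with h | h
      · exact h1 u h
      · obtain rfl : u = t := by omega
        omega
    · rw [cumul_succ, h3, hsum, sum_Icc_succ_top (by omega), hwi]
      omega
    · rcases Nat.lt_or_ge u t with h | h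
      · exact h4 u h hfree
      · obtain rfl : u = t := by omega
        rw [hwl] at hfree
        rw [hwi, h3]
        omega

/-! ### `Routine`: making machines available in a slot -/

theorem cumul_setEntry_self (y : Alloc n) (i : Fin n) {t u : ℕ} (h1 : 1 ≤ t) (h2 : t ≤ u)
    (a : ℕ) : cumul (setEntry y i t a) i u + y i t = cumul y i u + a := by
  have ht : t ∈ Icc 1 u := mem_Icc.2 ⟨h1, h2⟩
  have h3 : ∑ v ∈ (Icc 1 u).erase t, setEntry y i t a i v = ∑ v ∈ (Icc 1 u).erase t, y i v :=
    sum_congr rfl fun v hv => setEntry_of_slot_ne y i i (ne_of_mem_erase hv) a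
  have h4 : cumul y i u = y i t + ∑ v ∈ (Icc 1 u).erase t, y i v := (add_sum_erase _ _ ht).symm
  have h5 : cumul (setEntry y i t a) i u = setEntry y i t a i t
      + ∑ v ∈ (Icc 1 u).erase t, setEntry y i t a i v := (add_sum_erase _ _ ht).symm
  rw [setEntry_self] at h5
  omega

/-- Move one machine of task `j` from slot `t` to slot `t'`. -/
def moveUnit (y : Alloc n) (j : Fin n) (t t' : ℕ) : Alloc n :=
  setEntry (setEntry y j t (y j t - 1)) j t' (y j t' + 1)

theorem moveUnit_of_task_ne (y : Alloc n) {j j' : Fin n} (h : j' ≠ j) (t t' u : ℕ) :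
    moveUnit y j t t' j' u = y j' u := by
  simp [moveUnit, setEntry_of_task_ne _ h]

theorem moveUnit_of_slot_ne (y : Alloc n) (j j' : Fin n) {t t' u : ℕ} (h : u ≠ t) (h' : u ≠ t') :
    moveUnit y j t t' j' u = y j' u := by
  simp [moveUnit, setEntry_of_slot_ne _ _ _ h, setEntry_of_slot_ne _ _ _ h']

theorem moveUnit_source (y : Alloc n) (j : Fin n) {t t' : ℕ} (h : t ≠ t') :
    moveUnit y j t t' j t = y j t - 1 := by
  simp [moveUnit, setEntry_of_slot_ne _ _ _ h]

theorem moveUnit_target (y : Alloc n) (j : Fin n) (t t' : ℕ) :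
    moveUnit y j t t' j t' = y j t' + 1 := by
  simp [moveUnit]

theorem load_moveUnit_of_ne (y : Alloc n) (j : Fin n) {t t' u : ℕ} (h : u ≠ t) (h' : u ≠ t') :
    load (moveUnit y j t t') u = load y u :=
  load_congr fun j' => moveUnit_of_slot_ne y j j' h h'

theorem load_moveUnit_source (y : Alloc n) {j : Fin n} {t t' : ℕ} (h : t ≠ t')
    (hj : 0 < y j t) : load (moveUnit y j t t') t + 1 = load y t := by
  have := load_add_eq (y := y) (z := moveUnit y j t t') (t := t)
    fun j' hj' => moveUnit_of_task_ne y hj' t t' t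
  rw [moveUnit_source y j h] at this
  omega

theorem load_moveUnit_target (y : Alloc n) (j : Fin n) (t t' : ℕ) :
    load (moveUnit y j t t') t' = load y t' + 1 := by
  have := load_add_eq (y := y) (z := moveUnit y j t t') (t := t')
    fun j' hj' => moveUnit_of_task_ne y hj' t t' t'
  rw [moveUnit_target y j] at this
  omega

theorem cumul_moveUnit_of_lt (y : Alloc n) (j j' : Fin n) {t t' u : ℕ} (h : u < t') (ht : t' < t) :
    cumul (moveUnit y j t t') j' u = cumul y j' u :=
  cumul_congr fun v _ hv => moveUnit_of_slot_ne y j j' (by omega) (by omega)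

theorem cumul_moveUnit_of_le (y : Alloc n) {j : Fin n} (j' : Fin n) {t t' u : ℕ} (h1 : 1 ≤ t')
    (ht : t' < t) (h : t ≤ u) (hj : 0 < y j t) :
    cumul (moveUnit y j t t') j' u = cumul y j' u := by
  by_cases hj' : j' = j
  · subst hj'
    have h2 := cumul_setEntry_self y j' (t := t) (u := u) (by omega) h (y j' t - 1)
    have h3 := cumul_setEntry_self (setEntry y j' t (y j' t - 1)) j' (t := t') (u := u)
      h1 (by omega) (y j' t' + 1)
    rw [setEntry_of_slot_ne y j' j' (by omega)] at h3
    unfold moveUnit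
    omega
  · exact cumul_congr fun v _ _ => moveUnit_of_task_ne y hj' t t' v

theorem val_routine_succ (I : Inst n) (ρ : SearchOrder n) (i : Fin n) (th t Δ m : ℕ)
    (y : Alloc n) :
    (routine I ρ i th (t + 1) Δ (m + 1) y).val =
      if I.C - load y (t + 1) < Δ then
        match (lastFree I y t).val with
        | none => y
        | some t' =>
          if t' ≤ th then y
          else if cumul y i (t' - 1) ≤ I.C - load y (t + 1) then y
          else
            match (findTask y (t + 1) t' ((List.finRange n).map (ρ y (t + 1) t'))).val with
            | none => y
            | some j =>
              (routine I ρ i th (t + 1) Δ m (setEntry (setEntry y j (t + 1) (y j (t + 1) - 1)) j t'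
                (setEntry y j (t + 1) (y j (t + 1) - 1) j t' + 1))).val
      else y := by
  rw [← val_avail]
  refine (val_ite_step _ _ _).trans ?_
  refine if_congr Iff.rfl ?_ rfl
  simp only [val_bind, val_step, Nat.add_sub_cancel]
  cases (lastFree I y t).val with
  | none => rfl
  | some t' =>
    refine (val_ite_step _ _ _).trans ?_
    refine if_congr Iff.rfl rfl ?_
    simp only [val_bind, val_step]
    rw [← val_prefixSum]
    refine (val_ite_step _ _ _).trans ?_
    refine if_congr Iff.rfl rfl ?_
    simp only [val_bind]
    cases (findTask y (t + 1) t' ((List.finRange n).map (ρ y (t + 1) t'))).val <;> rfl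

/-- One pass of `Routine` at slot `t + 1`: either it stops, in which case enough machines are
available or none can be taken from a slot beyond the threshold without emptying the earlier
slots, or it moves one machine of another task to the last slot with an available machine. -/
theorem routine_pass (I : Inst n) (ρ : SearchOrder n) (i : Fin n) (th t Δ m : ℕ) (y : Alloc n)
    (hcap : ∀ u, load y u ≤ I.C) (hsat : Saturated I y i t) (hΔ : Δ + y i (t + 1) ≤ (I.T i).k) :
    ((routine I ρ i th (t + 1) Δ (m + 1) y).val = y ∧
      (Δ ≤ I.C - load y (t + 1) ∨
        ∀ u, th ≤ u → u < t → load y (u + 1) < I.C → cumul y i u ≤ I.C - load y (t + 1))) ∨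
    ∃ j s, j ≠ i ∧ th ≤ s ∧ s < t ∧ load y (s + 1) < I.C ∧
      (∀ v, s < v → v < t → I.C ≤ load y (v + 1)) ∧
      I.C - load y (t + 1) < Δ ∧ I.C - load y (t + 1) < cumul y i s ∧
      y j (s + 1) < y j (t + 1) ∧
      (routine I ρ i th (t + 1) Δ (m + 1) y).val =
        (routine I ρ i th (t + 1) Δ m (moveUnit y j (t + 1) (s + 1))).val := by
  rw [val_routine_succ]
  split_ifs with h1
  swap
  · exact Or.inl ⟨rfl, Or.inl (by omega)⟩
  cases hl : (lastFree I y t).val with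
  | none =>
    refine Or.inl ⟨rfl, Or.inr fun u _ hu hfree => ?_⟩
    have := lastFree_eq_none I y hl (u + 1) (by omega) (by omega)
    omega
  | some t' =>
    obtain ⟨h2, h3, h4, h5⟩ := lastFree_eq_some I y hl
    obtain ⟨s, rfl⟩ : ∃ s, t' = s + 1 := ⟨t' - 1, by omega⟩
    have hlast : ∀ u, u < t → load y (u + 1) < I.C → u ≤ s := fun u hu hfree => by
      by_contra hs
      have := h5 (u + 1) (by omega) (by omega)
      omega
    simp only [Nat.add_sub_cancel]
    split_ifs with h6 h7
    · refine Or.inl ⟨rfl, Or.inr fun u hth hu hfree => ?_⟩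
      have := hlast u hu hfree
      omega
    · refine Or.inl ⟨rfl, Or.inr fun u hth hu hfree => ?_⟩
      exact (cumul_mono y i (hlast u hu hfree)).trans h7
    -- The other tasks leave at least `k_i + 1` machines in slot `s + 1`, where task `i` uses `k_i`
    -- and one is available, but fewer than `k_i` in slot `t + 1`: some task uses more there.
    have hk : y i (s + 1) = (I.T i).k := (hsat s (by omega) h4).resolve_right (by omega)
    have hload := hcap (t + 1)
    cases hf : (findTask y (t + 1) (s + 1)
        ((List.finRange n).map (ρ y (t + 1) (s + 1)))).val with
    | none =>
      exfalso
      have hle : ∀ j, y j (t + 1) ≤ y j (s + 1) := fun j =>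
        findTask_eq_none y _ _ hf j
          (List.mem_map.2 ⟨(ρ y (t + 1) (s + 1)).symm j, List.mem_finRange _, by simp⟩)
      have h8 : ∑ j ∈ univ.erase i, y j (t + 1) ≤ ∑ j ∈ univ.erase i, y j (s + 1) :=
        sum_le_sum fun j _ => hle j
      have h9 := load_eq_add_erase y i (t + 1)
      have h10 := load_eq_add_erase y i (s + 1)
      omega
    | some j =>
      have h8 := findTask_eq_some y _ _ hf
      refine Or.inr ⟨j, s, ?_, by omega, by omega, h4,
        fun v hv hvt => h5 (v + 1) (by omega) (by omega), h1, by omega, h8, ?_⟩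
      · rintro rfl
        omega
      · simp only [moveUnit]
        rw [setEntry_of_slot_ne y j j (by omega)]

/-- What `Routine`, called at slot `t + 1` on behalf of task `i` and asked for `Δ` machines, does to
the allocation `y`. The machines made available in slot `t + 1` number `I.C - load y' (t + 1)`. -/
structure RoutineSpec (I : Inst n) (i : Fin n) (th t Δ : ℕ) (y y' : Alloc n) : Prop where
  same : ∀ u, y' i u = y i u
  le_k : (∀ j u, y j u ≤ (I.T j).k) → ∀ j u, y' j u ≤ (I.T j).k
  cap : ∀ u, load y' u ≤ I.C
  low : ∀ j u, u ≤ th → y' j u = y j u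
  high : ∀ j u, t + 1 < u → y' j u = y j u
  supp : ∀ j u, y' j u ≠ 0 → ∃ v, u ≤ v ∧ y j v ≠ 0
  mono : ∀ u, u ≤ t → load y u ≤ load y' u
  total : ∀ j, cumul y' j (t + 1) = cumul y j (t + 1)
  avail_le : I.C - load y' (t + 1) ≤ Δ
  /-- If all slots between `u` and `t + 1` are full, then machines are made available only by
  moves to slots up to `u`, hence at most as many as task `i` uses before. -/
  guard : ∀ u, (∀ v, u ≤ v → v < t → I.C ≤ load y (v + 1)) →
    I.C - load y (t + 1) ≤ cumul y i u → I.C - load y' (t + 1) ≤ cumul y i u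
  /-- If a move crosses the boundary after slot `u`, then all slots from there to `t` are full, and
  the machines made available are at most as many as task `i` uses up to slot `u`. -/
  cross : ∀ u, u ≤ t → (∀ j, cumul y' j u = cumul y j u) ∨
    ((∀ v, u ≤ v → v < t → I.C ≤ load y' (v + 1)) ∧ I.C - load y' (t + 1) ≤ cumul y i u)
  exit : I.C - load y' (t + 1) = Δ ∨
    ∀ u, th ≤ u → u < t → load y' (u + 1) < I.C → cumul y i u ≤ I.C - load y' (t + 1)

theorem RoutineSpec.refl (I : Inst n) (i : Fin n) (th t Δ : ℕ) (y : Alloc n)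
    (hcap : ∀ u, load y u ≤ I.C) (hle : I.C - load y (t + 1) ≤ Δ)
    (hexit : Δ ≤ I.C - load y (t + 1) ∨
      ∀ u, th ≤ u → u < t → load y (u + 1) < I.C → cumul y i u ≤ I.C - load y (t + 1)) :
    RoutineSpec I i th t Δ y y where
  same _ := rfl
  le_k h := h
  cap := hcap
  low _ _ _ := rfl
  high _ _ _ := rfl
  supp _ u h := ⟨u, le_rfl, h⟩
  mono _ _ := le_rfl
  total _ := rfl
  avail_le := hle
  guard _ _ h := h
  cross _ _ := Or.inl fun _ => rfl
  exit := hexit.imp_left fun h => by omega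

theorem routine_spec (I : Inst n) (ρ : SearchOrder n) (i : Fin n) (th t Δ m : ℕ) (y : Alloc n)
    (hcap : ∀ u, load y u ≤ I.C) (hsat : Saturated I y i t) (hΔ : Δ + y i (t + 1) ≤ (I.T i).k)
    (hm : I.C - load y (t + 1) + m = Δ) :
    RoutineSpec I i th t Δ y (routine I ρ i th (t + 1) Δ m y).val := by
  induction m generalizing y with
  | zero =>
    exact RoutineSpec.refl I i th t Δ y hcap (by omega) (Or.inl (by omega))
  | succ m ih =>
    rcases routine_pass I ρ i th t Δ m y hcap hsat hΔ with
      ⟨h1, h2⟩ | ⟨j, s, hj, hths, hst, hfree, hfull, hlt, hp, hjs, heq⟩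
    · rw [h1]
      exact RoutineSpec.refl I i th t Δ y hcap (by omega) h2
    rw [heq]
    set z := moveUnit y j (t + 1) (s + 1) with hz
    have hzi : ∀ u, z i u = y i u := fun u => moveUnit_of_task_ne y hj.symm _ _ u
    have hzc : ∀ u, cumul z i u = cumul y i u := fun u => cumul_congr fun v _ _ => hzi v
    have hsrc : load z (t + 1) + 1 = load y (t + 1) :=
      load_moveUnit_source y (by omega) (by omega)
    have htgt : load z (s + 1) = load y (s + 1) + 1 := load_moveUnit_target y j _ _
    have hoth : ∀ u, u ≠ t + 1 → u ≠ s + 1 → load z u = load y u := fun u h h' =>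
      load_moveUnit_of_ne y j h h'
    have hcapt := hcap (t + 1)
    have hmono : ∀ u, u ≤ t → load y u ≤ load z u := fun u hu => by
      by_cases hus : u = s + 1
      · subst hus; omega
      · rw [hoth u (by omega) hus]
    have hzcap : ∀ u, load z u ≤ I.C := fun u => by
      by_cases hus : u = s + 1
      · subst hus; omega
      · by_cases hut : u = t + 1
        · subst hut; omega
        · rw [hoth u hut hus]; exact hcap u
    have hzsat : Saturated I z i t := fun u hu hf => by
      rw [hzi, hzc]
      exact hsat u hu ((hmono (u + 1) (by omega)).trans_lt hf)
    have spec := ih z hzcap hzsat (by rw [hzi]; exact hΔ) (by omega)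
    set y' := (routine I ρ i th (t + 1) Δ m z).val with hy'
    have hlast : ∀ u, (∀ v, u ≤ v → v < t → I.C ≤ load y (v + 1)) → s < u := fun u hu => by
      by_contra h
      have := hu s (by omega) hst
      omega
    -- After a move across the boundary, the machines obtained are bounded by what precedes it.
    have hcross : ∀ u, s < u → I.C - load y' (t + 1) ≤ cumul y i u := fun u hu => by
      have := cumul_mono y i hu.le
      rw [← hzc]
      refine spec.guard u (fun v hv hvt => ?_) (by rw [hzc]; omega)
      exact (hfull v (by omega) hvt).trans (hmono _ (by omega))
    exact
      { same := fun u => (spec.same u).trans (hzi u)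
        le_k := fun h => spec.le_k fun j' u => by
          by_cases hj' : j' = j
          · subst hj'
            by_cases hu : u = s + 1
            · subst hu
              rw [hz, moveUnit_target]
              exact hjs.trans_le (h j' _)
            · by_cases hu' : u = t + 1
              · subst hu'
                rw [hz, moveUnit_source y j' (by omega)]
                exact (Nat.sub_le _ _).trans (h j' _)
              · rw [hz, moveUnit_of_slot_ne y j' j' hu' hu]
                exact h j' u
          · rw [hz, moveUnit_of_task_ne y hj']
            exact h j' u
        cap := spec.cap
        low := fun j' u hu => (spec.low j' u hu).trans
          (moveUnit_of_slot_ne y j j' (by omega) (by omega))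
        high := fun j' u hu => (spec.high j' u hu).trans
          (moveUnit_of_slot_ne y j j' (by omega) (by omega))
        supp := fun j' u hu => by
          obtain ⟨v, huv, hv⟩ := spec.supp j' u hu
          by_cases hj' : j' = j
          · subst hj'
            by_cases hvs : v = s + 1
            · exact ⟨t + 1, by omega, by omega⟩
            · by_cases hvt : v = t + 1
              · exact ⟨t + 1, by omega, by omega⟩
              · exact ⟨v, huv, by rwa [hz, moveUnit_of_slot_ne y j' j' hvt hvs] at hv⟩
          · exact ⟨v, huv, by rwa [hz, moveUnit_of_task_ne y hj'] at hv⟩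
        mono := fun u hu => (hmono u hu).trans (spec.mono u hu)
        total := fun j' => (spec.total j').trans
          (cumul_moveUnit_of_le y j' (by omega) (by omega) le_rfl (by omega))
        avail_le := spec.avail_le
        guard := fun u hu _ => hcross u (hlast u hu)
        cross := fun u hu => by
          rcases Nat.lt_or_ge s u with h | h
          · refine Or.inr ⟨fun v hv hvt => ?_, hcross u h⟩
            exact (hfull v (by omega) hvt).trans
              ((hmono _ (by omega)).trans (spec.mono _ (by omega)))
          · rcases spec.cross u hu with h1 | h1
            · exact Or.inl fun j' => (h1 j').trans
                (cumul_moveUnit_of_lt y j j' (by omega) (by omega))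
            · rw [hzc] at h1
              exact Or.inr h1
        exit := by simpa only [hzc] using spec.exit }

/-! ### `AllocateRLM`: the pass over the slots -/

theorem load_le_of_eq_of_le {y z : Alloc n} {i : Fin n} {t : ℕ} (h : ∀ j, j ≠ i → z j t = y j t)
    (hi : z i t ≤ y i t) : load z t ≤ load y t := by
  have := load_add_eq h
  omega

theorem sum_erase_congr {y z : Alloc n} {i : Fin n} {t : ℕ} (h : ∀ j, j ≠ i → z j t = y j t) :
    ∑ j ∈ univ.erase i, z j t = ∑ j ∈ univ.erase i, y j t :=
  sum_congr rfl fun j hj => h j (ne_of_mem_erase hj)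

/-- What one pass of `AllocateRLM` at slot `t + 1` does to the allocation `y` when it asks for at
least one machine. -/
structure TransferSpec (I : Inst n) (i : Fin n) (th t : ℕ) (y z : Alloc n) : Prop where
  cap : ∀ u, load z u ≤ I.C
  le_k : ∀ j u, z j u ≤ (I.T j).k
  sat : Saturated I z i t
  zero : ∀ j, z j 0 = y j 0
  low : ∀ j, j ≠ i → ∀ u, u ≤ th → z j u = y j u
  high : ∀ j u, t + 1 < u → z j u = y j u
  supp : ∀ j, j ≠ i → ∀ u, z j u ≠ 0 → ∃ v, u ≤ v ∧ y j v ≠ 0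
  total : ∀ j, cumul z j (t + 1) = cumul y j (t + 1)
  cumul_le : ∀ u, u ≤ t → cumul z i u ≤ cumul y i u
  top : I.C ≤ load z (t + 1)
  full : ∀ u, (∀ v, u ≤ v → v < t → I.C ≤ load y (v + 1)) →
    ∀ v, u ≤ v → v < t → I.C ≤ load z (v + 1)
  others : ∀ u, u < t →
    ∑ j ∈ univ.erase i, y j (u + 1) ≤ ∑ j ∈ univ.erase i, z j (u + 1)
  cross : ∀ u, u ≤ t → (∀ j, j ≠ i → cumul z j u = cumul y j u) ∨
    ∀ v, u ≤ v → v < t → I.C ≤ load z (v + 1)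
  shape : ∀ u, th ≤ u → u < t → z i (t + 1) = (I.T i).k ∨ cumul z i u = 0 ∨
    ∀ v, u ≤ v → v < t → I.C ≤ load z (v + 1)

theorem transfer_spec (I : Inst n) (ρ : SearchOrder n) (i : Fin n) (th t Δ : ℕ) (y : Alloc n)
    (hcap : ∀ u, load y u ≤ I.C) (hk : ∀ j u, y j u ≤ (I.T j).k) (hsat : Saturated I y i (t + 1))
    (hΔ : Δ = min ((I.T i).k - y i (t + 1)) (cumul y i t)) (hpos : 0 < Δ)
    {y₁ : Alloc n} (hy₁ : y₁ = (routine I ρ i th (t + 1) Δ Δ y).val) {θ : ℕ}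
    (hθ : θ = I.C - load y₁ (t + 1)) :
    TransferSpec I i th t y
      (drain i t 1 θ (setEntry y₁ i (t + 1) (y₁ i (t + 1) + θ))).val := by
  have hki := hk i (t + 1)
  have hfull : I.C ≤ load y (t + 1) := by
    by_contra h
    have := hsat t (by omega) (by omega)
    omega
  have spec : RoutineSpec I i th t Δ y y₁ := by
    rw [hy₁]
    exact routine_spec I ρ i th t Δ Δ y hcap (fun u hu => hsat u (by omega)) (by omega) (by omega)
  set y₂ := setEntry y₁ i (t + 1) (y₁ i (t + 1) + θ) with hy₂
  set z := (drain i t 1 θ y₂).val with hz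
  have hθle : θ ≤ Δ := hθ ▸ spec.avail_le
  have h₂ : ∀ j u, u ≠ t + 1 → y₂ j u = y₁ j u := fun j u hu => setEntry_of_slot_ne y₁ i j hu _
  have h₂c : ∀ u, u ≤ t → cumul y₂ i u = cumul y i u := fun u hu =>
    cumul_congr fun v _ hv => (h₂ i v (by omega)).trans (spec.same v)
  have hzne : ∀ j, j ≠ i → ∀ u, z j u = y₁ j u := fun j hj u =>
    (drain_of_ne hj t 1 θ y₂ u).trans (setEntry_of_task_ne y₁ hj _ _ u)
  have hztop : z i (t + 1) = y i (t + 1) + θ := by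
    rw [hz, drain_of_lt i (by omega), hy₂, setEntry_self, spec.same]
  have hzhigh : ∀ j u, t + 1 < u → z j u = y₁ j u := fun j u hu =>
    (drain_of_lt i (by omega) θ y₂ j).trans (h₂ j u (by omega))
  have hz0 : ∀ j, z j 0 = y₁ j 0 := fun j => (drain_zero i t θ y₂ j).trans (h₂ j 0 (by omega))
  have hzlow : ∀ u, u < t → z i (u + 1) = y i (u + 1) - (θ - cumul y i u) := fun u hu => by
    rw [hz, drain_succ i hu, h₂ i _ (by omega), spec.same, h₂c u (by omega)]
  have hzc : ∀ u, u ≤ t → cumul z i u = cumul y i u - θ := fun u hu => by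
    rw [hz, cumul_drain i hu, h₂c u hu]
  have hltop : load z (t + 1) = I.C := by
    have h1 := load_add_eq (y := y₁) (z := z) (t := t + 1) fun j hj => hzne j hj _
    have h2 := spec.cap (t + 1)
    rw [hztop, spec.same] at h1
    omega
  have hlle : ∀ u, u < t → load z (u + 1) ≤ load y₁ (u + 1) := fun u hu =>
    load_le_of_eq_of_le (fun j hj => hzne j hj _) (by rw [hzlow u hu, spec.same]; omega)
  -- Slots before which task `i` retains something are not touched by `drain`.
  have hleq : ∀ u, θ ≤ cumul y i u → ∀ v, u ≤ v → v < t → load z (v + 1) = load y₁ (v + 1) :=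
    fun u hu v huv hv => by
      have h1 := cumul_mono y i huv
      refine load_congr fun j => ?_
      by_cases hj : j = i
      · subst hj
        rw [hzlow v hv, spec.same]
        omega
      · exact hzne j hj _
  exact
    { cap := fun u => by
        by_cases hu : u = t + 1
        · subst hu; omega
        · by_cases hut : t + 1 < u
          · rw [load_congr fun j => hzhigh j u hut]; exact spec.cap u
          · rcases Nat.eq_zero_or_pos u with rfl | hu0
            · rw [load_congr hz0]; exact spec.cap 0
            · obtain ⟨v, rfl⟩ : ∃ v, u = v + 1 := ⟨u - 1, by omega⟩
              exact (hlle v (by omega)).trans (spec.cap _)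
      le_k := fun j u => by
        by_cases hj : j = i
        · subst hj
          by_cases hu : u = t + 1
          · subst hu; omega
          · by_cases hut : t + 1 < u
            · rw [hzhigh j u hut]; exact spec.le_k hk j u
            · rcases Nat.eq_zero_or_pos u with rfl | hu0
              · rw [hz0]; exact spec.le_k hk j 0
              · obtain ⟨v, rfl⟩ : ∃ v, u = v + 1 := ⟨u - 1, by omega⟩
                rw [hzlow v (by omega)]
                exact (Nat.sub_le _ _).trans (hk j _)
        · rw [hzne j hj]; exact spec.le_k hk j u
      sat := fun u hu hfree => by
        rw [hzc u hu.le]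
        by_cases h : cumul y i u ≤ θ
        · exact Or.inr (by omega)
        · rw [hleq u (by omega) u le_rfl hu] at hfree
          have h1 := spec.mono (u + 1) (by omega)
          rw [hzlow u hu]
          rcases hsat u (by omega) (by omega) with h2 | h2 <;> omega
      zero := fun j => (hz0 j).trans (spec.low j 0 (Nat.zero_le _))
      low := fun j hj u hu => (hzne j hj u).trans (spec.low j u hu)
      high := fun j u hu => (hzhigh j u hu).trans (spec.high j u hu)
      supp := fun j hj u hu => spec.supp j u (by rwa [← hzne j hj])
      total := fun j => by
        by_cases hj : j = i
        · subst hj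
          rw [cumul_succ, cumul_succ, hzc t le_rfl, hztop]
          omega
        · exact (cumul_congr fun v _ _ => hzne j hj v).trans (spec.total j)
      cumul_le := fun u hu => by rw [hzc u hu]; omega
      top := hltop.ge
      full := fun u hu v huv hv => by
        have h1 := spec.guard u hu (by omega)
        rw [hleq u (by omega) v huv hv]
        exact (hu v huv hv).trans (spec.mono _ (by omega))
      others := fun u hu => by
        rw [sum_erase_congr fun j hj => hzne j hj (u + 1)]
        have h1 := spec.mono (u + 1) (by omega)
        rw [load_eq_add_erase y i, load_eq_add_erase y₁ i, spec.same] at h1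
        omega
      cross := fun u hu => (spec.cross u hu).imp
        (fun h j hj => (cumul_congr fun v _ _ => hzne j hj v).trans (h j))
        fun h v huv hv => by
          rw [hleq u (by omega) v huv hv]
          exact h.1 v huv hv
      shape := fun u hth hu => by
        rcases spec.exit with h | h
        · have h1 := cumul_mono y i hu.le
          rw [hztop, hzc u hu.le]
          omega
        · by_cases h1 : ∃ v, u ≤ v ∧ v < t ∧ load y₁ (v + 1) < I.C
          · obtain ⟨v, huv, hv, hfree⟩ := h1
            have h2 := h v (by omega) hv hfree
            have h3 := cumul_mono y i huv
            rw [hzc u hu.le]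
            omega
          · by_cases h2 : θ ≤ cumul y i u
            · refine Or.inr (Or.inr fun v huv hv => ?_)
              rw [hleq u h2 v huv hv]
              by_contra h3
              exact h1 ⟨v, huv, hv, by omega⟩
            · rw [hzc u hu.le]
              omega }

/-- What `AllocateRLM` does to the allocation `y` when it runs from slot `t` downwards on behalf of
task `i` with threshold `th`. -/
structure RLMSpec (I : Inst n) (i : Fin n) (th t : ℕ) (y z : Alloc n) : Prop where
  cap : ∀ u, load z u ≤ I.C
  le_k : ∀ j u, z j u ≤ (I.T j).k
  zero : ∀ j, z j 0 = y j 0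
  low : ∀ j, j ≠ i → ∀ u, u ≤ th → z j u = y j u
  high : ∀ j u, t < u → z j u = y j u
  supp : ∀ j, j ≠ i → ∀ u, z j u ≠ 0 → ∃ v, u ≤ v ∧ y j v ≠ 0
  total : ∀ j, cumul z j t = cumul y j t
  cumul_le : ∀ u, u ≤ t → cumul z i u ≤ cumul y i u
  /-- Slots that are full up to the end remain full. -/
  full : ∀ u, (∀ v, u ≤ v → v < t → I.C ≤ load y (v + 1)) →
    ∀ v, u ≤ v → v < t → I.C ≤ load z (v + 1)
  /-- The other tasks lose nothing in a slot that is not full in the end. -/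
  others : ∀ u, u < t → load z (u + 1) < I.C →
    ∑ j ∈ univ.erase i, y j (u + 1) ≤ ∑ j ∈ univ.erase i, z j (u + 1)
  /-- The other tasks are not moved across the beginning of a slot that is not full in the end. -/
  cross : ∀ u, u < t → load z (u + 1) < I.C → ∀ j, j ≠ i → cumul z j u = cumul y j u
  /-- From a slot beyond the threshold on that is not full in the end, task `i` uses its full
  parallelism, unless it uses no earlier slot. -/
  shape : ∀ u, th ≤ u → u < t → load z (u + 1) < I.C →
    cumul z i u = 0 ∨ ∀ v, u ≤ v → v < t → z i (v + 1) = (I.T i).k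

theorem val_allocateRLM_succ (I : Inst n) (ρ : SearchOrder n) (i : Fin n) (th t : ℕ)
    (y : Alloc n) :
    (allocateRLM I ρ i th (t + 1) y).val =
      if 0 < cumul y i t then
        if 0 < min ((I.T i).k - y i (t + 1)) (cumul y i t) then
          let y₁ := (routine I ρ i th (t + 1) (min ((I.T i).k - y i (t + 1)) (cumul y i t))
            (min ((I.T i).k - y i (t + 1)) (cumul y i t)) y).val
          let θ := I.C - load y₁ (t + 1)
          (allocateRLM I ρ i th t
            (drain i t 1 θ (setEntry y₁ i (t + 1) (y₁ i (t + 1) + θ))).val).val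
        else (allocateRLM I ρ i th t y).val
      else y := by
  simp only [← val_prefixSum, ← val_avail]
  refine (val_ite_step _ _ _).trans ?_
  refine if_congr Iff.rfl ?_ rfl
  exact val_ite_step _ _ _

theorem allocateRLM_spec (I : Inst n) (ρ : SearchOrder n) (i : Fin n) (th t : ℕ) (y : Alloc n)
    (hcap : ∀ u, load y u ≤ I.C) (hk : ∀ j u, y j u ≤ (I.T j).k) (hsat : Saturated I y i t) :
    RLMSpec I i th t y (allocateRLM I ρ i th t y).val := by
  induction t generalizing y with
  | zero =>
    exact
      { cap := hcap
        le_k := hk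
        zero := fun _ => rfl
        low := fun _ _ _ _ => rfl
        high := fun _ _ _ => rfl
        supp := fun _ _ u hu => ⟨u, le_rfl, hu⟩
        total := fun _ => rfl
        cumul_le := fun _ _ => le_rfl
        full := fun _ _ _ _ h => by omega
        others := fun _ h => by omega
        cross := fun _ h => by omega
        shape := fun _ _ h => by omega }
  | succ t ih =>
    rw [val_allocateRLM_succ]
    have hki := hk i (t + 1)
    split_ifs with hp hΔ
    · dsimp only
      have tr := transfer_spec I ρ i th t _ y hcap hk hsat rfl hΔ rfl rfl
      set z := (drain i t 1 _ _).val with hz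
      have spec := ih z tr.cap tr.le_k tr.sat
      set y' := (allocateRLM I ρ i th t z).val with hy'
      have htop : I.C ≤ load y' (t + 1) :=
        tr.top.trans (load_congr fun j => spec.high j (t + 1) (by omega)).ge
      have hlt : ∀ u, u < t + 1 → load y' (u + 1) < I.C → u < t := fun u hu hfree => by
        rcases Nat.lt_or_ge u t with h | h
        · exact h
        · obtain rfl : u = t := by omega
          omega
      exact
        { cap := spec.cap
          le_k := spec.le_k
          zero := fun j => (spec.zero j).trans (tr.zero j)
          low := fun j hj u hu => (spec.low j hj u hu).trans (tr.low j hj u hu)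
          high := fun j u hu => (spec.high j u (by omega)).trans (tr.high j u hu)
          supp := fun j hj u hu => by
            obtain ⟨v, huv, hv⟩ := spec.supp j hj u hu
            obtain ⟨w, hvw, hw⟩ := tr.supp j hj v hv
            exact ⟨w, huv.trans hvw, hw⟩
          total := fun j => by
            rw [← tr.total, cumul_succ, cumul_succ, spec.total, spec.high j (t + 1) (by omega)]
          cumul_le := fun u hu => by
            rcases Nat.lt_or_ge t u with h | h
            · obtain rfl : u = t + 1 := by omega
              rw [← tr.total, cumul_succ, cumul_succ, spec.total, spec.high i (t + 1) (by omega)]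
            · exact (spec.cumul_le u h).trans (tr.cumul_le u h)
          full := fun u hu v huv hv => by
            rcases Nat.lt_or_ge v t with h | h
            · exact spec.full u (tr.full u fun w huw hw => hu w huw (by omega)) v huv h
            · obtain rfl : v = t := by omega
              exact htop
          others := fun u hu hfree =>
            (tr.others u (hlt u hu hfree)).trans (spec.others u (hlt u hu hfree) hfree)
          cross := fun u hu hfree j hj => by
            have hut := hlt u hu hfree
            rcases tr.cross u hut.le with h | h
            · exact (spec.cross u hut hfree j hj).trans (h j hj)
            · have := spec.full u h u le_rfl hut
              omega
          shape := fun u hth hu hfree => by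
            have hut := hlt u hu hfree
            rcases spec.shape u hth hut hfree with h | h
            · exact Or.inl h
            · rcases tr.shape u hth hut with h1 | h1 | h1
              · refine Or.inr fun v huv hv => ?_
                rcases Nat.lt_or_ge v t with h2 | h2
                · exact h v huv h2
                · obtain rfl : v = t := by omega
                  rw [spec.high i (v + 1) (by omega), h1]
              · have := spec.cumul_le u hut.le
                exact Or.inl (by omega)
              · have := spec.full u h1 u le_rfl hut
                omega }
    · have spec := ih y hcap hk fun u hu => hsat u (by omega)
      set y' := (allocateRLM I ρ i th t y).val with hy'
      have hsame : ∀ j, y' j (t + 1) = y j (t + 1) := fun j => spec.high j (t + 1) (by omega)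
      exact
        { cap := spec.cap
          le_k := spec.le_k
          zero := spec.zero
          low := spec.low
          high := fun j u hu => spec.high j u (by omega)
          supp := spec.supp
          total := fun j => by rw [cumul_succ, cumul_succ, spec.total, hsame]
          cumul_le := fun u hu => by
            rcases Nat.lt_or_ge t u with h | h
            · obtain rfl : u = t + 1 := by omega
              rw [cumul_succ, cumul_succ, spec.total, hsame]
            · exact spec.cumul_le u h
          full := fun u hu v huv hv => by
            rcases Nat.lt_or_ge v t with h | h
            · exact spec.full u (fun w huw hw => hu w huw (by omega)) v huv h
            · obtain rfl : v = t := by omega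
              exact (hu v huv hv).trans (load_congr hsame).ge
          others := fun u hu hfree => by
            rcases Nat.lt_or_ge u t with h | h
            · exact spec.others u h hfree
            · obtain rfl : u = t := by omega
              exact (sum_congr rfl fun j _ => hsame j).ge
          cross := fun u hu hfree j hj => by
            rcases Nat.lt_or_ge u t with h | h
            · exact spec.cross u h hfree j hj
            · obtain rfl : u = t := by omega
              exact spec.total j
          shape := fun u hth hu hfree => by
            have htop : y' i (t + 1) = (I.T i).k := by
              rw [hsame]
              omega
            have hex : ∀ v, ¬ v < t → v < t + 1 → y' i (v + 1) = (I.T i).k := fun v h1 h2 => by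
              obtain rfl : v = t := by omega
              exact htop
            rcases Nat.lt_or_ge u t with h | h
            · exact (spec.shape u hth h hfree).imp_right fun h1 v huv hv =>
                if hvt : v < t then h1 v huv hvt else hex v hvt hv
            · exact Or.inr fun v huv hv => hex v (by omega) hv }
    · exact
        { cap := hcap
          le_k := hk
          zero := fun _ => rfl
          low := fun _ _ _ _ => rfl
          high := fun _ _ _ => rfl
          supp := fun _ _ u hu => ⟨u, le_rfl, hu⟩
          total := fun _ => rfl
          cumul_le := fun _ _ => le_rfl
          full := fun _ h => h
          others := fun _ _ _ => le_rfl
          cross := fun _ _ _ _ _ => rfl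
          shape := fun u _ hu _ => by
            have := cumul_mono y i (show u ≤ t by omega)
            exact Or.inl (by omega) }

/-! ### `Allocate-A` -/

theorem cumul_eq_of_late {y : Alloc n} {j : Fin n} {d e : ℕ} (h : ∀ u, d < u → y j u = 0)
    (hde : d ≤ e) : cumul y j e = cumul y j d :=
  (sum_subset (Icc_subset_Icc_right hde) fun u hu hu' => h u (by
    rw [mem_Icc] at hu hu'
    omega)).symm

theorem cumul_le_add_mul {y : Alloc n} {j : Fin n} {k : ℕ} (h : ∀ u, y j u ≤ k) (u e : ℕ) :
    cumul y j (u + e) ≤ cumul y j u + k * e := by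
  induction e with
  | zero => simp
  | succ e ih =>
    have := h (u + e + 1)
    rw [← add_assoc, cumul_succ, mul_add]
    omega

theorem cumul_eq_add_mul {y : Alloc n} {j : Fin n} {k u e : ℕ}
    (h : ∀ v, u ≤ v → v < u + e → y j (v + 1) = k) : cumul y j (u + e) = cumul y j u + k * e := by
  induction e with
  | zero => simp
  | succ e ih =>
    have := h (u + e) (by omega) (by omega)
    rw [← add_assoc, cumul_succ, mul_add, ih fun v h1 h2 => h v h1 (by omega)]
    omega

/-- What `Allocate-A(i)` does to an allocation `y` in which task `i` does not occur yet. -/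
structure AllocateSpec (I : Inst n) (i : Fin n) (th : ℕ) (y z : Alloc n) : Prop where
  cap : ∀ u, load z u ≤ I.C
  le_k : ∀ j u, z j u ≤ (I.T j).k
  zero : ∀ j, z j 0 = y j 0
  late : ∀ u, (I.T i).d < u → z i u = 0
  completed : cumul z i (I.T i).d = (I.T i).D
  supp : ∀ j, j ≠ i → ∀ u, z j u ≠ 0 → ∃ v, u ≤ v ∧ y j v ≠ 0
  total : ∀ j, j ≠ i → ∀ u, (I.T i).d ≤ u → cumul z j u = cumul y j u
  load_mono : ∀ u, u ≤ th → load y u ≤ load z u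
  free : ∀ u, load z (u + 1) < I.C → load y (u + 1) < I.C
  cross : ∀ u, load z (u + 1) < I.C → ∀ j, j ≠ i → cumul z j u = cumul y j u
  shape : ∀ u, th ≤ u → u < (I.T i).d → load z (u + 1) < I.C →
    cumul z i u = 0 ∨ ∀ v, u ≤ v → v < (I.T i).d → z i (v + 1) = (I.T i).k

theorem allocateA_spec (I : Inst n) (ρ : SearchOrder n) (i : Fin n) (th : ℕ) (y : Alloc n)
    (hcap : ∀ u, load y u ≤ I.C) (hk : ∀ j u, y j u ≤ (I.T j).k) (hi : ∀ u, y i u = 0)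
    (hD : (allocatable I y i).val = true) :
    AllocateSpec I i th y (allocateA I ρ i th y).val := by
  rw [val_allocatable] at hD
  change AllocateSpec I i th y (allocateRLM I ρ i th (I.T i).d
    (fullyUtilize I i (I.T i).d (I.T i).D y).val).val
  obtain ⟨h1, h2, h3, h4⟩ := fullyUtilize_spec I i (I.T i).d (I.T i).D y
    (fun u _ => hi (u + 1)) hcap
  have hne : ∀ j, j ≠ i → ∀ u, (fullyUtilize I i (I.T i).d (I.T i).D y).val j u = y j u :=
    fun j hj => fullyUtilize_of_ne I hj _ _ y
  have hhigh : ∀ j u, (I.T i).d < u →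
      (fullyUtilize I i (I.T i).d (I.T i).D y).val j u = y j u :=
    fun j u hu => fullyUtilize_of_lt I i j hu _ y
  have hzero : ∀ j, (fullyUtilize I i (I.T i).d (I.T i).D y).val j 0 = y j 0 :=
    fun j => fullyUtilize_zero I i j _ _ y
  generalize (fullyUtilize I i (I.T i).d (I.T i).D y).val = x at *
  have hxk : ∀ j u, x j u ≤ (I.T j).k := fun j u => by
    by_cases hj : j = i
    · subst hj
      rcases Nat.eq_zero_or_pos u with rfl | hu
      · rw [hzero]; exact hk j 0
      · rcases Nat.lt_or_ge (I.T j).d u with hu' | hu'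
        · rw [hhigh j u hu']; exact hk j u
        · obtain ⟨v, rfl⟩ : ∃ v, u = v + 1 := ⟨u - 1, by omega⟩
          exact h1 v (by omega)
    · rw [hne j hj]; exact hk j u
  have spec := allocateRLM_spec I ρ i th (I.T i).d x h2 hxk h4
  generalize (allocateRLM I ρ i th (I.T i).d x).val = z at *
  have hzhigh : ∀ j u, (I.T i).d < u → z j u = y j u := fun j u hu =>
    (spec.high j u hu).trans (hhigh j u hu)
  have htotal : ∀ j, j ≠ i → ∀ u, (I.T i).d ≤ u → cumul z j u = cumul y j u := by
    intro j hj u hu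
    induction u, hu using Nat.le_induction with
    | base => exact (spec.total j).trans (cumul_congr fun v _ _ => hne j hj v)
    | succ u hu ih => rw [cumul_succ, cumul_succ, ih, hzhigh j (u + 1) (by omega)]
  exact
    { cap := spec.cap
      le_k := spec.le_k
      zero := fun j => (spec.zero j).trans (hzero j)
      late := fun u hu => (hzhigh i u hu).trans (hi u)
      completed := by rw [spec.total, h3]; omega
      supp := fun j hj u hu => by
        obtain ⟨v, huv, hv⟩ := spec.supp j hj u hu
        exact ⟨v, huv, by rwa [← hne j hj]⟩
      total := htotal
      load_mono := fun u hu => by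
        refine sum_le_sum fun j _ => ?_
        by_cases hj : j = i
        · subst hj; rw [hi]; exact Nat.zero_le _
        · rw [spec.low j hj u hu, hne j hj]
      free := fun u hfree => by
        rcases Nat.lt_or_ge u (I.T i).d with hu | hu
        · have h5 := spec.others u hu hfree
          rw [sum_erase_congr fun j hj => hne j hj (u + 1)] at h5
          have h6 := load_eq_add_erase y i (u + 1)
          have h7 := load_eq_add_erase z i (u + 1)
          have h8 := hi (u + 1)
          omega
        · rwa [load_congr fun j => hzhigh j (u + 1) (by omega)] at hfree
      cross := fun u hfree j hj => by
        rcases Nat.lt_or_ge u (I.T i).d with hu | hu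
        · exact (spec.cross u hu hfree j hj).trans (cumul_congr fun v _ _ => hne j hj v)
        · exact htotal j hj u hu
      shape := spec.shape }

/-! ### The packing bound -/

theorem sum_inter_insert {P S : Finset (Fin n)} {i : Fin n} (hi : i ∉ P) (f : Fin n → ℝ) :
    ∑ j ∈ S ∩ insert i P, f j = (if i ∈ S then f i else 0) + ∑ j ∈ S ∩ P, f j := by
  split_ifs with h
  · rw [inter_insert_of_mem h, sum_insert fun h' => hi (mem_inter.1 h').2]
  · rw [inter_insert_of_notMem h, zero_add]

/-- A packing bound. Suppose that at least the fraction `r` of the machine-slots in `1, …, τ` is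
busy, that the deadlines of the tasks in `P` that are not in `A` are at most `τ`, and that the tasks
in `A` are completed and use the slots after `τ` as much as they can. Then the tasks in `P` that
any one schedule completes have at most `1 / r` times the workload of `A`. -/
theorem workload_le {I : Inst n} {A P S : Finset (Fin n)} {y z : Alloc n} {r : ℝ} {τ : ℕ}
    (hr0 : 0 ≤ r) (hr1 : r ≤ 1) (hz : I.Feasible S z)
    (hnot : ∀ j, j ∉ A → ∀ u, y j u = 0)
    (hlate : ∀ j u, (I.T j).d < u → y j u = 0)
    (htotal : ∀ j ∈ A, cumul y j (I.T j).d = (I.T j).D)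
    (hrej : ∀ j ∈ P, j ∉ A → (I.T j).d ≤ τ)
    (hutil : r * (I.C * τ) ≤ ∑ u ∈ Icc 1 τ, (load y u : ℝ))
    (hpacked : ∀ j ∈ A, τ < (I.T j).d →
      cumul y j τ ≤ (I.T j).D - (I.T j).k * ((I.T j).d - τ)) :
    r * ∑ j ∈ S ∩ P, ((I.T j).D : ℝ) ≤ ∑ j ∈ A, ((I.T j).D : ℝ) := by
  have hle : ∀ j ∈ A, cumul y j τ ≤ (I.T j).D := fun j hj => by
    rcases Nat.lt_or_ge τ (I.T j).d with h | h
    · rw [← htotal j hj]; exact cumul_mono y j h.le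
    · rw [cumul_eq_of_late (hlate j) h, htotal j hj]
  have hjob : ∀ j ∈ S ∩ P,
      (I.T j).D ≤ cumul z j τ + if j ∈ A then (I.T j).D - cumul y j τ else 0 := fun j hj => by
    obtain ⟨hjS, hjP⟩ := mem_inter.1 hj
    have hc : (I.T j).D ≤ cumul z j (I.T j).d := hz.completed j hjS
    rcases Nat.lt_or_ge τ (I.T j).d with h | h
    · have hA : j ∈ A := by
        by_contra hA
        have := hrej j hjP hA
        omega
      have h1 := hpacked j hA h
      have h2 := cumul_le_add_mul (hz.parallelism j) τ ((I.T j).d - τ)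
      rw [Nat.add_sub_cancel' h.le] at h2
      rw [if_pos hA]
      omega
    · exact (hc.trans (cumul_mono z j h)).trans (Nat.le_add_right _ _)
  have h1 : ∑ j ∈ S ∩ P, (I.T j).D ≤ I.C * τ + ∑ j ∈ A, ((I.T j).D - cumul y j τ) := by
    refine (sum_le_sum hjob).trans ?_
    rw [sum_add_distrib]
    refine add_le_add ?_ ?_
    · calc ∑ j ∈ S ∩ P, cumul z j τ ≤ ∑ j, cumul z j τ := sum_le_sum_of_subset (subset_univ _)
        _ = ∑ u ∈ Icc 1 τ, load z u := sum_cumul z τ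
        _ ≤ ∑ u ∈ Icc 1 τ, I.C := sum_le_sum fun u _ => hz.capacity u
        _ = I.C * τ := by simp [mul_comm]
    · calc ∑ j ∈ S ∩ P, (if j ∈ A then (I.T j).D - cumul y j τ else 0)
          ≤ ∑ j, (if j ∈ A then (I.T j).D - cumul y j τ else 0) :=
            sum_le_sum_of_subset (subset_univ _)
        _ = ∑ j ∈ A, ((I.T j).D - cumul y j τ) := by rw [sum_ite_mem, univ_inter]
  have h2 : ∑ u ∈ Icc 1 τ, load y u = ∑ j ∈ A, cumul y j τ := by
    rw [← sum_cumul]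
    refine (sum_subset (subset_univ A) fun j _ hj => ?_).symm
    exact sum_eq_zero fun u _ => hnot j hj u
  have h3 : ∑ j ∈ A, ((I.T j).D - cumul y j τ) + ∑ j ∈ A, cumul y j τ = ∑ j ∈ A, (I.T j).D := by
    rw [← sum_add_distrib]
    exact sum_congr rfl fun j hj => Nat.sub_add_cancel (hle j hj)
  have h1' : ∑ j ∈ S ∩ P, ((I.T j).D : ℝ)
      ≤ I.C * τ + (∑ j ∈ A, ((I.T j).D - cumul y j τ) : ℕ) := by exact_mod_cast h1
  have h2' : ∑ u ∈ Icc 1 τ, (load y u : ℝ) = (∑ j ∈ A, cumul y j τ : ℕ) := by exact_mod_cast h2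
  have h3' : ((∑ j ∈ A, ((I.T j).D - cumul y j τ) : ℕ) : ℝ) + (∑ j ∈ A, cumul y j τ : ℕ)
      = ∑ j ∈ A, ((I.T j).D : ℝ) := by exact_mod_cast h3
  have h4 := mul_le_mul_of_nonneg_left h1' hr0
  have h5 : r * ((∑ j ∈ A, ((I.T j).D - cumul y j τ) : ℕ) : ℝ)
      ≤ (∑ j ∈ A, ((I.T j).D - cumul y j τ) : ℕ) :=
    mul_le_of_le_one_left (Nat.cast_nonneg _) hr1
  rw [mul_add] at h4
  linarith

/-! ### The invariant of the main loop -/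

theorem scanFull_spec (I : Inst n) (y : Alloc n) (m c : ℕ) :
    c ≤ (scanFull I y m c).val ∧
    (∀ u, c ≤ u → u < (scanFull I y m c).val → I.C ≤ load y (u + 1)) ∧
    (c + m ≤ (scanFull I y m c).val ∨ load y ((scanFull I y m c).val + 1) < I.C) := by
  induction m generalizing c with
  | zero => exact ⟨le_rfl, fun u h1 (h2 : u < c) => by omega, Or.inl le_rfl⟩
  | succ m ih =>
    have h : (scanFull I y (m + 1) c).val =
        if 0 < I.C - load y (c + 1) then c else (scanFull I y m (c + 1)).val := by
      rw [← val_avail]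
      exact val_ite_step _ _ _
    rw [h]
    split_ifs with h0
    · exact ⟨le_rfl, fun u h1 h2 => by omega, Or.inr (by omega)⟩
    · obtain ⟨h1, h2, h3⟩ := ih (c + 1)
      refine ⟨by omega, fun u h4 h5 => ?_, h3.imp_left fun h => by omega⟩
      rcases Nat.eq_or_lt_of_le h4 with rfl | h6
      · omega
      · exact h2 u h6 h5

theorem threshold_spec (I : Inst n) (y : Alloc n) (c c' : ℕ) :
    c ≤ (threshold I y c c').val ∧
    (∀ u, c ≤ u → u < (threshold I y c c').val → I.C ≤ load y (u + 1)) ∧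
    (c' ≤ (threshold I y c c').val ∨ load y ((threshold I y c c').val + 1) < I.C) := by
  have h : (threshold I y c c').val = if c' ≤ c then c else (scanFull I y (c' - c) c).val :=
    val_ite_step _ _ _
  rw [h]
  split_ifs with h0
  · exact ⟨le_rfl, fun u h1 h2 => by omega, Or.inl h0⟩
  · obtain ⟨h1, h2, h3⟩ := scanFull_spec I y (c' - c) c
    exact ⟨h1, h2, h3.imp_left fun h => by omega⟩

/-- The invariant of the main loop, for a state `g` reached after the tasks in `P` have been
considered, and the approximation ratio `r`. -/
structure LoopInv (I : Inst n) (r : ℝ) (P : Finset (Fin n)) (g : GState n) : Prop where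
  cap : ∀ u, load g.y u ≤ I.C
  le_k : ∀ j u, g.y j u ≤ (I.T j).k
  zero : ∀ j, g.y j 0 = 0
  late : ∀ j u, (I.T j).d < u → g.y j u = 0
  not_mem : ∀ j, j ∉ g.accepted → ∀ u, g.y j u = 0
  completed : ∀ j ∈ g.accepted, cumul g.y j (I.T j).d = (I.T j).D
  sub : g.accepted ⊆ P
  rejected_le : ∀ j ∈ P, j ∉ g.accepted → (I.T j).d ≤ g.c
  accepted_le : ∀ j ∈ g.accepted, (I.T j).d ≤ g.c'
  util : r * (I.C * g.c) ≤ ∑ u ∈ Icc 1 g.c, (load g.y u : ℝ)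
  full : ∀ u, g.c ≤ u → u < g.th → I.C ≤ load g.y (u + 1)
  /-- From a slot beyond the threshold on in which a machine is available, every accepted task
  processes as much as it could possibly process there. -/
  packed : ∀ j ∈ g.accepted, ∀ u, g.th ≤ u → u < (I.T j).d → load g.y (u + 1) < I.C →
    cumul g.y j u ≤ (I.T j).D - (I.T j).k * ((I.T j).d - u)
  work : ∀ S z, I.Feasible S z →
    r * ∑ j ∈ S ∩ P, ((I.T j).D : ℝ) ≤ ∑ j ∈ g.accepted, ((I.T j).D : ℝ)
  /-- The surplus of workload in `work`, rated at a marginal value that none of the tasks in `P`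
  falls short of, is contained in the surplus of value. -/
  value : ∀ S z, I.Feasible S z → ∀ μ, 0 ≤ μ → (∀ j ∈ P, μ ≤ I.marginal j) →
    r * I.welfare (S ∩ P) + μ * (∑ j ∈ g.accepted, ((I.T j).D : ℝ)
      - r * ∑ j ∈ S ∩ P, ((I.T j).D : ℝ)) ≤ I.welfare g.accepted

theorem Inst.Valid.marginal_mul {I : Inst n} (hI : I.Valid) (i : Fin n) :
    I.marginal i * (I.T i).D = (I.T i).v :=
  div_mul_cancel₀ _ (Nat.cast_ne_zero.2 (hI.D_pos i).ne')

theorem Inst.Valid.marginal_nonneg {I : Inst n} (hI : I.Valid) (i : Fin n) :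
    0 ≤ I.marginal i :=
  div_nonneg (hI.v_nonneg i) (Nat.cast_nonneg _)

/-- Abel summation, one term at a time: `w` and `x` are the workloads and `a` and `b` the values
on the two sides, so far, and `e` and `f` tell which fractions of a further task of workload `D`
and marginal value `m` count on either side. -/
theorem value_step {w x a b e f D m μ : ℝ} (h : b + m * (w - x) ≤ a) (hμ : μ ≤ m)
    (hwx : x + f * D ≤ w + e * D) :
    b + f * (m * D) + μ * (w + e * D - (x + f * D)) ≤ a + e * (m * D) := by
  nlinarith [mul_nonneg (sub_nonneg.2 hμ) (sub_nonneg.2 hwx)]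

theorem LoopInv.accept {I : Inst n} {r : ℝ} {P : Finset (Fin n)} {g : GState n} (hI : I.Valid)
    (hr1 : r ≤ 1) (h : LoopInv I r P g) (ρ : SearchOrder n) {i : Fin n}
    (hi : i ∉ P) (hsort : ∀ j ∈ P, I.marginal i ≤ I.marginal j)
    (hD : (allocatable I g.y i).val = true) (hc : g.c ≤ g.th) :
    LoopInv I r (insert i P)
      { g with
        y := (allocateA I ρ i g.th g.y).val
        accepted := insert i g.accepted
        c' := max g.c' (I.T i).d } := by
  have hiA : i ∉ g.accepted := fun h' => hi (h.sub h')
  have spec := allocateA_spec I ρ i g.th g.y h.cap h.le_k (h.not_mem i hiA) hD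
  generalize (allocateA I ρ i g.th g.y).val = z at *
  have hlate : ∀ j u, (I.T j).d < u → z j u = 0 := fun j u hu => by
    by_cases hj : j = i
    · subst hj; exact spec.late u hu
    · by_contra hne
      obtain ⟨v, huv, hv⟩ := spec.supp j hj u hne
      exact hv (h.late j v (by omega))
  have hwork : ∀ S x, I.Feasible S x →
      r * ∑ j ∈ S ∩ insert i P, ((I.T j).D : ℝ)
        ≤ ∑ j ∈ insert i g.accepted, ((I.T j).D : ℝ) := fun S x hS => by
    rw [sum_inter_insert hi, sum_insert hiA, mul_add]
    refine add_le_add ?_ (h.work S x hS)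
    have hD0 : (0 : ℝ) ≤ (I.T i).D := Nat.cast_nonneg _
    split_ifs
    · exact mul_le_of_le_one_left hD0 hr1
    · rwa [mul_zero]
  exact
    { cap := spec.cap
      le_k := spec.le_k
      zero := fun j => (spec.zero j).trans (h.zero j)
      late := hlate
      not_mem := fun j hj u => by
        rw [mem_insert, not_or] at hj
        by_contra hne
        obtain ⟨v, huv, hv⟩ := spec.supp j hj.1 u hne
        exact hv (h.not_mem j hj.2 v)
      completed := fun j hj => by
        by_cases hji : j = i
        · subst hji; exact spec.completed
        · have hjA := mem_of_mem_insert_of_ne hj hji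
          have h1 := spec.total j hji (max (I.T i).d (I.T j).d) (le_max_left _ _)
          rw [cumul_eq_of_late (hlate j) (le_max_right _ _),
            cumul_eq_of_late (h.late j) (le_max_right _ _)] at h1
          exact h1.trans (h.completed j hjA)
      sub := insert_subset_insert i h.sub
      rejected_le := fun j hj hjA => by
        rw [mem_insert, not_or] at hjA
        exact h.rejected_le j (mem_of_mem_insert_of_ne hj hjA.1) hjA.2
      accepted_le := fun j hj => by
        rcases mem_insert.1 hj with rfl | hj
        · exact le_max_right _ _
        · exact (h.accepted_le j hj).trans (le_max_left _ _)
      util := h.util.trans (sum_le_sum fun u hu =>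
        Nat.cast_le.2 (spec.load_mono u ((mem_Icc.1 hu).2.trans hc)))
      full := fun u h1 h2 => (h.full u h1 h2).trans (spec.load_mono _ h2)
      packed := fun j hj u hth hu hfree => by
        rcases mem_insert.1 hj with rfl | hjA
        · have hue : u + ((I.T j).d - u) = (I.T j).d := Nat.add_sub_cancel' hu.le
          rcases spec.shape u hth hu hfree with h1 | h1
          · dsimp only
            omega
          · have h2 := cumul_eq_add_mul (y := z) (j := j) (k := (I.T j).k) (u := u)
              (e := (I.T j).d - u) fun v h3 h4 => h1 v h3 (by omega)
            rw [hue, spec.completed] at h2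
            dsimp only
            omega
        · have hji : j ≠ i := fun h' => hiA (h' ▸ hjA)
          dsimp only
          rw [spec.cross u hfree j hji]
          exact h.packed j hjA u hth hu (spec.free u hfree)
      work := hwork
      value := fun S x hS μ hμ0 hμ => by
        have h1 := h.value S x hS (I.marginal i) (hI.marginal_nonneg i) hsort
        have h2 := hwork S x hS
        have h3 := hμ i (mem_insert_self i P)
        have h4 := hI.marginal_mul i
        simp only [Inst.welfare] at h1 ⊢
        rw [sum_inter_insert hi, sum_insert hiA] at h2
        rw [sum_inter_insert hi, sum_inter_insert hi, sum_insert hiA, sum_insert hiA, ← h4]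
        have h5 := value_step (e := 1) (f := if i ∈ S then r else 0) (D := (I.T i).D) h1 h3
          (by split_ifs at h2 ⊢ <;> linarith)
        split_ifs at h5 ⊢ <;> linarith }

/-- When task `i` is rejected, the machines that are left over up to its deadline amount to at most
`len i` entirely empty slots. -/
theorem load_of_not_allocatable {I : Inst n} (hI : I.Valid) {y : Alloc n}
    (hcap : ∀ u, load y u ≤ I.C) {i : Fin n} (h : (allocatable I y i).val = false) :
    (I.C : ℝ) * ((I.T i).d - I.len i) ≤ ∑ u ∈ Icc 1 (I.T i).d, (load y u : ℝ) := by
  have hD : ¬ (I.T i).D ≤ ∑ u ∈ Icc 1 (I.T i).d, min (I.C - load y u) (I.T i).k := by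
    rw [← val_allocatable, h]
    exact Bool.false_ne_true
  have hk := hI.k_pos i
  have hlen : (I.T i).D ≤ (I.T i).k * I.len i := by
    have h1 : ((I.T i).D : ℝ) / (I.T i).k ≤ I.len i := Nat.le_ceil _
    rw [div_le_iff₀ (Nat.cast_pos.2 hk), mul_comm] at h1
    exact_mod_cast h1
  have hslot : ∀ u, (I.T i).k * (I.C - load y u)
      ≤ I.C * min (I.C - load y u) (I.T i).k := fun u => by
    rcases le_total (I.C - load y u) (I.T i).k with h1 | h1
    · rw [min_eq_left h1]
      exact Nat.mul_le_mul_right _ (hI.k_le i)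
    · rw [min_eq_right h1, mul_comm]
      exact Nat.mul_le_mul_right _ (Nat.sub_le _ _)
  have hfree : ∑ u ∈ Icc 1 (I.T i).d, (I.C - load y u) ≤ I.C * I.len i := by
    refine Nat.le_of_mul_le_mul_left ?_ hk
    calc (I.T i).k * ∑ u ∈ Icc 1 (I.T i).d, (I.C - load y u)
        ≤ ∑ u ∈ Icc 1 (I.T i).d, I.C * min (I.C - load y u) (I.T i).k := by
          rw [mul_sum]
          exact sum_le_sum fun u _ => hslot u
      _ = I.C * ∑ u ∈ Icc 1 (I.T i).d, min (I.C - load y u) (I.T i).k := (mul_sum _ _ _).symm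
      _ ≤ I.C * ((I.T i).k * I.len i) := Nat.mul_le_mul_left _ (by omega)
      _ = (I.T i).k * (I.C * I.len i) := mul_left_comm _ _ _
  have hsum : ∑ u ∈ Icc 1 (I.T i).d, (I.C - load y u) + ∑ u ∈ Icc 1 (I.T i).d, load y u
      = I.C * (I.T i).d := by
    rw [← sum_add_distrib, sum_congr rfl fun u _ => Nat.sub_add_cancel (hcap u)]
    simp [mul_comm]
  have h1 : I.C * (I.T i).d ≤ I.C * I.len i + ∑ u ∈ Icc 1 (I.T i).d, load y u := by omega
  have h2 : (I.C : ℝ) * (I.T i).d ≤ I.C * I.len i + ∑ u ∈ Icc 1 (I.T i).d, (load y u : ℝ) := by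
    exact_mod_cast h1
  linarith

theorem LoopInv.reject {I : Inst n} {r : ℝ} {P : Finset (Fin n)} {g : GState n} (hI : I.Valid)
    (hr0 : 0 ≤ r) (hr1 : r ≤ 1) (hr : ∀ j, r * (I.T j).d ≤ (I.T j).d - I.len j)
    (h : LoopInv I r P g) {i : Fin n}
    (hi : i ∉ P) (hsort : ∀ j ∈ P, I.marginal i ≤ I.marginal j)
    (hD : (allocatable I g.y i).val = false) :
    LoopInv I r (insert i P) { g with c := max g.c (I.T i).d } := by
  have hiA : i ∉ g.accepted := fun h' => hi (h.sub h')
  have hC : (0 : ℝ) ≤ I.C := Nat.cast_nonneg _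
  have hrej : ∀ j ∈ insert i P, j ∉ g.accepted → (I.T j).d ≤ max g.c (I.T i).d :=
    fun j hj hjA => by
      rcases mem_insert.1 hj with rfl | hj
      · exact le_max_right _ _
      · exact (h.rejected_le j hj hjA).trans (le_max_left _ _)
  have hutil : r * (I.C * (max g.c (I.T i).d : ℕ))
      ≤ ∑ u ∈ Icc 1 (max g.c (I.T i).d), (load g.y u : ℝ) := by
    rcases max_choice g.c (I.T i).d with hm | hm <;> rw [hm]
    · exact h.util
    · refine le_trans ?_ (load_of_not_allocatable hI h.cap hD)
      have := mul_le_mul_of_nonneg_left (hr i) hC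
      linarith
  have hfull : ∀ u, max g.c (I.T i).d ≤ u → u < g.th → I.C ≤ load g.y (u + 1) :=
    fun u h1 h2 => h.full u ((le_max_left _ _).trans h1) h2
  generalize max g.c (I.T i).d = c at *
  have hwork : ∀ S x, I.Feasible S x →
      r * ∑ j ∈ S ∩ insert i P, ((I.T j).D : ℝ)
        ≤ ∑ j ∈ g.accepted, ((I.T j).D : ℝ) := fun S x hS => by
    obtain ⟨h1, h2, h3⟩ := threshold_spec I g.y c g.c'
    generalize (threshold I g.y c g.c').val = τ at *
    refine workload_le (τ := τ) hr0 hr1 hS h.not_mem h.late h.completed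
      (fun j hj hjA => (hrej j hj hjA).trans h1) ?_ fun j hj hτ => ?_
    · have h4 : ∀ m, c ≤ m → m ≤ τ →
          r * (I.C * m) ≤ ∑ u ∈ Icc 1 m, (load g.y u : ℝ) := by
        intro m hm
        induction m, hm using Nat.le_induction with
        | base => exact fun _ => hutil
        | succ m hm ih =>
          intro hmτ
          have h5 := ih (by omega)
          have h6 : (I.C : ℝ) ≤ load g.y (m + 1) := Nat.cast_le.2 (h2 m hm (by omega))
          have h7 := mul_le_of_le_one_left hC hr1
          rw [sum_Icc_succ_top (by omega)]
          push_cast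
          linarith
      exact h4 τ h1 le_rfl
    · rcases h3 with h3 | h3
      · have := h.accepted_le j hj
        omega
      · refine h.packed j hj τ ?_ hτ h3
        by_contra hth
        have := hfull τ h1 (by omega)
        omega
  exact
    { cap := h.cap
      le_k := h.le_k
      zero := h.zero
      late := h.late
      not_mem := h.not_mem
      completed := h.completed
      sub := h.sub.trans (subset_insert i P)
      rejected_le := hrej
      accepted_le := h.accepted_le
      util := hutil
      full := hfull
      packed := h.packed
      work := hwork
      value := fun S x hS μ hμ0 hμ => by
        have h1 := h.value S x hS (I.marginal i) (hI.marginal_nonneg i) hsort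
        have h2 := hwork S x hS
        have h3 := hμ i (mem_insert_self i P)
        have h4 := hI.marginal_mul i
        simp only [Inst.welfare] at h1 ⊢
        rw [sum_inter_insert hi] at h2
        rw [sum_inter_insert hi, sum_inter_insert hi, ← h4]
        have h5 := value_step (e := 0) (f := if i ∈ S then r else 0) (D := (I.T i).D) h1 h3
          (by split_ifs at h2 ⊢ <;> linarith)
        split_ifs at h5 ⊢ <;> linarith }

theorem LoopInv.updateThreshold {I : Inst n} {r : ℝ} {P : Finset (Fin n)} {g : GState n}
    (h : LoopInv I r P g) :
    LoopInv I r P { g with th := (threshold I g.y g.c g.c').val } := by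
  obtain ⟨h1, h2, h3⟩ := threshold_spec I g.y g.c g.c'
  exact
    { h with
      full := h2
      packed := fun j hj u hth hu hfree => by
        refine h.packed j hj u ?_ hu hfree
        by_contra hlt
        exact (h.full u (h1.trans hth) (not_le.1 hlt)).not_gt hfree }

/-- The hypothesis `hc` expresses that the threshold is up to date whenever the next task is going
to be accepted. -/
theorem greedyLoop_spec {I : Inst n} {r : ℝ} (hI : I.Valid) (hr0 : 0 ≤ r) (hr1 : r ≤ 1)
    (hr : ∀ j, r * (I.T j).d ≤ (I.T j).d - I.len j) (ρ : SearchOrder n) (l : List (Fin n))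
    (P : Finset (Fin n)) (g : GState n) (h : LoopInv I r P g) (hl : l.Nodup)
    (hP : ∀ i ∈ l, i ∉ P) (hsort : l.Pairwise fun i j => I.marginal j ≤ I.marginal i)
    (hPl : ∀ j ∈ P, ∀ i ∈ l, I.marginal i ≤ I.marginal j)
    (hc : (endOfPhase I g.y l).val = true → g.c ≤ g.th) :
    LoopInv I r (P ∪ l.toFinset) (greedyLoop I ρ l g).val := by
  induction l generalizing P g with
  | nil => simpa [greedyLoop] using h
  | cons i l ih =>
    have hi : i ∉ P := hP i List.mem_cons_self
    have hsi : ∀ j ∈ P, I.marginal i ≤ I.marginal j := fun j hj => hPl j hj i List.mem_cons_self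
    rw [List.nodup_cons] at hl
    rw [List.pairwise_cons] at hsort
    have hP' : ∀ j ∈ l, j ∉ insert i P := fun j hj hmem => by
      rcases mem_insert.1 hmem with rfl | hmem
      · exact hl.1 hj
      · exact hP j (List.mem_cons_of_mem _ hj) hmem
    have hPl' : ∀ j ∈ insert i P, ∀ k ∈ l, I.marginal k ≤ I.marginal j := fun j hj k hk => by
      rcases mem_insert.1 hj with rfl | hj
      · exact hsort.1 k hk
      · exact hPl j hj k (List.mem_cons_of_mem _ hk)
    have hU : P ∪ (i :: l).toFinset = insert i P ∪ l.toFinset := by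
      rw [List.toFinset_cons, union_insert, insert_union]
    rw [hU]
    cases hD : (allocatable I g.y i).val with
    | true =>
      have hval : (greedyLoop I ρ (i :: l) g).val = (greedyLoop I ρ l
          { g with
            y := (allocateA I ρ i g.th g.y).val
            accepted := insert i g.accepted
            c' := max g.c' (I.T i).d }).val := by
        simp [greedyLoop, hD]
      rw [hval]
      exact ih _ _ (h.accept hI hr1 ρ hi hsi hD (hc hD)) hl.2 hP' hsort.2 hPl' fun _ => hc hD
    | false =>
      have hrej := h.reject hI hr0 hr1 hr hi hsi hD
      cases hE : (endOfPhase I g.y l).val with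
      | true =>
        have hval : (greedyLoop I ρ (i :: l) g).val = (greedyLoop I ρ l
            { g with
              th := (threshold I g.y (max g.c (I.T i).d) g.c').val
              c := max g.c (I.T i).d }).val := by
          simp [greedyLoop, hD, hE]
        rw [hval]
        exact ih _ _ hrej.updateThreshold hl.2 hP' hsort.2 hPl' fun _ => (threshold_spec I _ _ _).1
      | false =>
        have hval : (greedyLoop I ρ (i :: l) g).val =
            (greedyLoop I ρ l { g with c := max g.c (I.T i).d }).val := by
          simp [greedyLoop, hD, hE]
        rw [hval]
        refine ih _ _ hrej hl.2 hP' hsort.2 hPl' fun hE' => ?_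
        rw [hE] at hE'
        exact absurd hE' Bool.false_ne_true

/-! ### Sorting and the approximation ratio -/

theorem val_insertTask_cons (I : Inst n) (i j : Fin n) (l : List (Fin n)) :
    (insertTask I i (j :: l)).val = open scoped Classical in
      if I.marginal j ≤ I.marginal i then i :: j :: l else j :: (insertTask I i l).val := by
  classical
  exact val_ite_step _ _ _

theorem insertTask_perm (I : Inst n) (i : Fin n) (l : List (Fin n)) :
    (insertTask I i l).val.Perm (i :: l) := by
  induction l with
  | nil => exact List.Perm.refl _
  | cons j l ih =>
    rw [val_insertTask_cons]
    split_ifs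
    · exact List.Perm.refl _
    · exact (ih.cons j).trans (List.Perm.swap i j l)

theorem insertTask_pairwise (I : Inst n) (i : Fin n) (l : List (Fin n))
    (h : l.Pairwise fun i j => I.marginal j ≤ I.marginal i) :
    (insertTask I i l).val.Pairwise fun i j => I.marginal j ≤ I.marginal i := by
  induction l with
  | nil => exact List.pairwise_singleton _ _
  | cons j l ih =>
    rw [val_insertTask_cons]
    have h' := List.pairwise_cons.1 h
    split_ifs with hji
    · refine List.pairwise_cons.2 ⟨fun k hk => ?_, h⟩
      rcases List.mem_cons.1 hk with rfl | hk
      · exact hji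
      · exact (h'.1 k hk).trans hji
    · refine List.pairwise_cons.2 ⟨fun k hk => ?_, ih h'.2⟩
      rcases List.mem_cons.1 ((insertTask_perm I i l).mem_iff.1 hk) with rfl | hk
      · exact (not_le.1 hji).le
      · exact h'.1 k hk

theorem sortTasks_perm (I : Inst n) (l : List (Fin n)) : (sortTasks I l).val.Perm l := by
  induction l with
  | nil => exact List.Perm.refl _
  | cons i l ih => exact (insertTask_perm I i _).trans (ih.cons i)

theorem sortTasks_pairwise (I : Inst n) (l : List (Fin n)) :
    (sortTasks I l).val.Pairwise fun i j => I.marginal j ≤ I.marginal i := by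
  induction l with
  | nil => exact List.Pairwise.nil
  | cons i l ih => exact insertTask_pairwise I i _ ih

theorem loopInv_init (I : Inst n) (r : ℝ) :
    LoopInv I r ∅ { y := fun _ _ => 0, accepted := ∅, th := 0, c := 0, c' := 0 } := by
  constructor <;> simp [load, Inst.welfare]

/-- At the end of the main loop, all tasks have been considered. -/
theorem greedyRLM_spec {I : Inst n} {r : ℝ} (hI : I.Valid) (hr0 : 0 ≤ r) (hr1 : r ≤ 1)
    (hr : ∀ j, r * (I.T j).d ≤ (I.T j).d - I.len j) (ρ : SearchOrder n) :
    ∃ g, LoopInv I r univ g ∧ (greedyRLM I ρ).val = (g.accepted, g.y) := by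
  have hperm := sortTasks_perm I (List.finRange n)
  have hmem : (sortTasks I (List.finRange n)).val.toFinset = univ := by
    ext i
    simp [hperm.mem_iff]
  refine ⟨_, ?_, rfl⟩
  have h := greedyLoop_spec hI hr0 hr1 hr ρ (sortTasks I (List.finRange n)).val ∅
    { y := fun _ _ => 0, accepted := ∅, th := 0, c := 0, c' := 0 } (loopInv_init I r)
    (hperm.nodup_iff.2 (List.nodup_finRange n)) (by simp) (sortTasks_pairwise I _) (by simp)
    fun _ => le_rfl
  rw [hmem, empty_union] at h
  exact h

theorem LoopInv.feasible {I : Inst n} {r : ℝ} {P : Finset (Fin n)} {g : GState n}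
    (h : LoopInv I r P g) : I.Feasible g.accepted g.y where
  support i t ht := by
    rcases ht with ht | rfl | ht
    · exact h.not_mem i ht t
    · exact h.zero i
    · exact h.late i t ht
  parallelism := h.le_k
  capacity := h.cap
  completed i hi := (h.completed i hi).ge

theorem LoopInv.mul_optWelfare_le {I : Inst n} {r : ℝ} {g : GState n} (hI : I.Valid)
    (hr0 : 0 ≤ r) (h : LoopInv I r univ g) : r * I.optWelfare ≤ I.welfare g.accepted := by
  have hset : ∀ w ∈ {w | ∃ S y, I.Feasible S y ∧ w = I.welfare S},
      r * w ≤ I.welfare g.accepted := by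
    rintro w ⟨S, z, hS, rfl⟩
    have := h.value S z hS 0 le_rfl fun j _ => hI.marginal_nonneg j
    rwa [zero_mul, add_zero, inter_univ] at this
  rcases hr0.eq_or_lt with rfl | hr
  · rw [zero_mul]
    exact sum_nonneg fun j _ => hI.v_nonneg j
  · rw [← le_div_iff₀' hr]
    refine csSup_le ⟨I.welfare g.accepted, _, _, h.feasible, rfl⟩ fun w hw => ?_
    rw [le_div_iff₀' hr]
    exact hset w hw

theorem Inst.Valid.one_le_len {I : Inst n} (hI : I.Valid) (i : Fin n) : 1 ≤ I.len i :=
  Nat.one_le_ceil_iff.2 (div_pos (Nat.cast_pos.2 (hI.D_pos i)) (Nat.cast_pos.2 (hI.k_pos i)))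

/-- The ratio `(s - 1) / s` is at most the fraction of busy machines up to the deadline of any
rejected task. -/
theorem Inst.Valid.ratio_le {I : Inst n} (hI : I.Valid) (hs : 1 ≤ I.minSlackness) (i : Fin n) :
    (I.minSlackness - 1) / I.minSlackness * (I.T i).d ≤ (I.T i).d - I.len i := by
  have hlen : (0 : ℝ) < I.len i := Nat.cast_pos.2 (hI.one_le_len i)
  have hs0 : 0 < I.minSlackness := by linarith
  have h1 : I.minSlackness ≤ (I.T i).d / I.len i := ciInf_le (Set.finite_range _).bddBelow i
  rw [le_div_iff₀ hlen] at h1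
  rw [div_mul_eq_mul_div, div_le_iff₀ hs0]
  linarith

theorem greedyRLM_correct (hn : 0 < n) (I : Inst n) (hI : I.Valid) (ρ : SearchOrder n) :
    I.Feasible (greedyRLM I ρ).val.1 (greedyRLM I ρ).val.2 ∧
      (I.minSlackness - 1) / I.minSlackness * I.optWelfare
        ≤ I.welfare (greedyRLM I ρ).val.1 := by
  have : Nonempty (Fin n) := ⟨⟨0, hn⟩⟩
  have hs : 1 ≤ I.minSlackness := le_ciInf hI.one_le_slackness
  have hr0 : 0 ≤ (I.minSlackness - 1) / I.minSlackness :=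
    div_nonneg (by linarith) (by linarith)
  have hr1 : (I.minSlackness - 1) / I.minSlackness ≤ 1 :=
    (div_le_one (by linarith)).2 (by linarith)
  obtain ⟨g, hg, hval⟩ := greedyRLM_spec hI hr0 hr1 (hI.ratio_le hs) ρ
  rw [hval]
  exact ⟨hg.feasible, hg.mul_optWelfare_le hI hr0⟩

/-! ### Running time -/

theorem steps_sumTasks (y : Alloc n) (t : ℕ) (l : List (Fin n)) :
    (sumTasks y t l).steps = 2 * l.length + 1 := by
  induction l with
  | nil => rfl
  | cons j l ih =>
    simp [sumTasks, ih, Nat.mul_succ]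
    omega

theorem steps_avail (I : Inst n) (y : Alloc n) (t : ℕ) : (avail I y t).steps = 2 * n + 2 := by
  simp [avail, steps_sumTasks]

theorem steps_prefixSum (y : Alloc n) (i : Fin n) (t : ℕ) :
    (prefixSum y i t).steps = 2 * t + 1 := by
  induction t with
  | zero => rfl
  | succ t ih =>
    simp [prefixSum, ih]
    omega

theorem steps_usable (I : Inst n) (y : Alloc n) (i : Fin n) (t : ℕ) :
    (usable I y i t).steps = t * (2 * n + 5) + 1 := by
  induction t with
  | zero => simp [usable]
  | succ t ih =>
    simp [usable, ih, steps_avail, Nat.succ_mul]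
    omega

theorem steps_allocatable (I : Inst n) (y : Alloc n) (i : Fin n) :
    (allocatable I y i).steps = (I.T i).d * (2 * n + 5) + 4 := by
  simp [allocatable, steps_usable]
  omega

theorem steps_fullyUtilize (I : Inst n) (i : Fin n) (t rem : ℕ) (y : Alloc n) :
    (fullyUtilize I i t rem y).steps = t * (2 * n + 7) := by
  induction t generalizing rem y with
  | zero => simp [fullyUtilize]
  | succ t ih =>
    simp [fullyUtilize, ih, steps_avail, Nat.succ_mul]
    omega

theorem steps_lastFree (I : Inst n) (y : Alloc n) (t : ℕ) :
    (lastFree I y t).steps ≤ t * (2 * n + 3) := by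
  induction t with
  | zero => simp [lastFree]
  | succ t ih =>
    rw [Nat.succ_mul]
    simp only [lastFree, steps_bind, steps_avail, steps_step]
    split
    · simp only [steps_pure]; omega
    · omega

theorem steps_findTask (y : Alloc n) (t t' : ℕ) (l : List (Fin n)) :
    (findTask y t t' l).steps ≤ 3 * l.length := by
  induction l with
  | nil => simp [findTask]
  | cons j l ih =>
    simp only [findTask, steps_bind, steps_step, List.length_cons]
    split
    · simp only [steps_pure]; omega
    · omega

theorem steps_drain (i : Fin n) (m u r : ℕ) (y : Alloc n) :
    (drain i m u r y).steps ≤ 5 * m := by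
  induction m generalizing u r y with
  | zero => simp [drain]
  | succ m ih =>
    simp only [drain, steps_bind, steps_step]
    split
    · simp only [steps_bind, steps_step, steps_write]
      have := ih (u + 1) (r - y i u) (setEntry y i u 0)
      simp only [val_step, val_write]
      omega
    · simp only [steps_bind, steps_step, steps_write]
      omega

theorem steps_routine (I : Inst n) (ρ : SearchOrder n) (i : Fin n) (th t Δ m : ℕ) (y : Alloc n) :
    (routine I ρ i th t Δ m y).steps ≤ m * (t * (2 * n + 5) + 5 * n + 20) := by
  induction m generalizing y with
  | zero => simp [routine]
  | succ m ih =>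
    have h1 : (t - 1) * (2 * n + 3) + 2 * t ≤ t * (2 * n + 5) := by
      have := Nat.mul_le_mul_right (2 * n + 3) (Nat.sub_le t 1)
      rw [show 2 * n + 5 = (2 * n + 3) + 2 from rfl, Nat.mul_add t]
      omega
    have h2 := steps_lastFree I y (t - 1)
    rw [Nat.succ_mul]
    simp only [routine, steps_bind, steps_step, steps_avail]
    split
    swap
    · simp only [steps_pure]; omega
    simp only [steps_bind, steps_step, val_step]
    cases hl : (lastFree I y (t - 1)).val with
    | none => simp only [steps_pure]; omega
    | some t' =>
      have h3 := (lastFree_eq_some I y hl).2.1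
      simp only [steps_bind, steps_step]
      split
      · simp only [steps_pure]; omega
      simp only [steps_bind, steps_step, steps_prefixSum]
      have h5 : (step (t' - 1)).val = t' - 1 := rfl
      split
      · simp only [steps_pure]; omega
      simp only [steps_bind]
      have h4 := steps_findTask y t t' ((List.finRange n).map (ρ y t t'))
      rw [List.length_map, List.length_finRange] at h4
      cases hf : (findTask y t t' ((List.finRange n).map (ρ y t t'))).val with
      | none => simp only [steps_pure]; omega
      | some j =>
        simp only [steps_bind, steps_step, steps_write]
        have h6 := ih (setEntry (setEntry y j t (y j t - 1)) j t'
          (setEntry y j t (y j t - 1) j t' + 1))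
        simp only [val_step, val_write]
        omega

/-- A bound on the steps that `Allocate-A` spends on each slot, if the deadline is at most `d` and
the parallelism bound is at most `k`. -/
def slotSteps (n d k : ℕ) : ℕ := k * (d * (2 * n + 5) + 5 * n + 20) + 7 * d + 2 * n + 20

theorem steps_allocateRLM (I : Inst n) (ρ : SearchOrder n) (i : Fin n) (th t d : ℕ) (ht : t ≤ d)
    (y : Alloc n) :
    (allocateRLM I ρ i th t y).steps ≤ t * slotSteps n d (I.T i).k := by
  induction t generalizing y with
  | zero => simp [allocateRLM]
  | succ t ih =>
    have ih := ih (by omega)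
    have hs : slotSteps n d (I.T i).k
      = (I.T i).k * (d * (2 * n + 5) + 5 * n + 20) + 7 * d + 2 * n + 20 := rfl
    rw [Nat.succ_mul]
    simp only [allocateRLM, steps_bind, steps_step, steps_prefixSum]
    split
    swap
    · simp only [steps_pure]; omega
    simp only [steps_bind, steps_step]
    split
    swap
    · grw [ih]
      omega
    simp only [steps_bind, steps_step, steps_avail, steps_write]
    grw [ih, steps_drain, steps_routine]
    have h1 : min ((I.T i).k - y i (t + 1)) (cumul y i t)
        * ((t + 1) * (2 * n + 5) + 5 * n + 20)
        ≤ (I.T i).k * (d * (2 * n + 5) + 5 * n + 20) := by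
      have h2 := Nat.mul_le_mul_right (2 * n + 5) ht
      exact Nat.mul_le_mul ((min_le_left _ _).trans (Nat.sub_le _ _)) (by omega)
    simp only [val_step, val_prefixSum]
    omega

theorem steps_allocateA (I : Inst n) (ρ : SearchOrder n) (i : Fin n) (th : ℕ) (y : Alloc n) :
    (allocateA I ρ i th y).steps ≤
      (I.T i).d * (2 * n + 7) + (I.T i).d * slotSteps n (I.T i).d (I.T i).k + 2 := by
  simp only [allocateA, steps_bind, steps_step, steps_fullyUtilize, val_step]
  grw [steps_allocateRLM _ _ _ _ _ (I.T i).d le_rfl]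
  omega

theorem steps_scanFull (I : Inst n) (y : Alloc n) (m c : ℕ) :
    (scanFull I y m c).steps ≤ m * (2 * n + 4) := by
  induction m generalizing c with
  | zero => simp [scanFull]
  | succ m ih =>
    rw [Nat.succ_mul]
    simp only [scanFull, steps_bind, steps_step, steps_avail]
    split
    · simp only [steps_pure]; omega
    · grw [ih]
      omega

theorem steps_threshold (I : Inst n) (y : Alloc n) (c c' : ℕ) :
    (threshold I y c c').steps ≤ c' * (2 * n + 4) + 2 := by
  simp only [threshold, steps_bind, steps_step]
  split
  · simp only [steps_pure]; omega
  · simp only [steps_bind, steps_step]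
    grw [steps_scanFull]
    have := Nat.mul_le_mul_right (2 * n + 4) (Nat.sub_le c' c)
    simp only [val_step]
    omega

/-- A bound on the steps of one pass of the main loop, if the deadlines are at most `d` and the
parallelism bounds are at most `k`. -/
def passSteps (n d k : ℕ) : ℕ := 4 * (d * (2 * n + 7)) + d * slotSteps n d k + 20

theorem slotSteps_mono {n d d' k k' : ℕ} (hd : d ≤ d') (hk : k ≤ k') :
    slotSteps n d k ≤ slotSteps n d' k' := by
  unfold slotSteps
  gcongr

theorem steps_greedyLoop (I : Inst n) (ρ : SearchOrder n) {d k : ℕ}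
    (hI : ∀ i, (I.T i).d ≤ d ∧ (I.T i).k ≤ k) (l : List (Fin n)) (g : GState n) (hg : g.c' ≤ d) :
    (greedyLoop I ρ l g).steps ≤ l.length * passSteps n d k := by
  induction l generalizing g with
  | nil => simp [greedyLoop]
  | cons i l ih =>
    have hp : passSteps n d k = 4 * (d * (2 * n + 7)) + d * slotSteps n d k + 20 := rfl
    have hall : ∀ y j, (allocatable I y j).steps ≤ d * (2 * n + 7) + 4 := fun y j => by
      rw [steps_allocatable]
      exact Nat.add_le_add_right (Nat.mul_le_mul (hI j).1 (by omega)) 4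
    have hend : ∀ y, (endOfPhase I y l).steps ≤ d * (2 * n + 7) + 4 := fun y => by
      cases l with
      | nil => simp [endOfPhase]
      | cons j l => exact hall y j
    have hA : ∀ th y, (allocateA I ρ i th y).steps
        ≤ d * (2 * n + 7) + d * slotSteps n d k + 2 := fun th y => by
      refine (steps_allocateA I ρ i th y).trans ?_
      have h1 := hI i
      have h2 := Nat.mul_le_mul h1.1 (slotSteps_mono (n := n) h1.1 h1.2)
      have h3 := Nat.mul_le_mul_right (2 * n + 7) h1.1
      omega
    have hth : ∀ y c, (threshold I y c g.c').steps ≤ d * (2 * n + 7) + 2 := fun y c =>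
      (steps_threshold I y c g.c').trans
        (Nat.add_le_add_right (Nat.mul_le_mul hg (by omega)) 2)
    have ih' : ∀ y A th c, (greedyLoop I ρ l ⟨y, A, th, c, g.c'⟩).steps
        ≤ l.length * passSteps n d k := fun y A th c => ih _ hg
    rw [List.length_cons, Nat.succ_mul]
    simp only [greedyLoop, steps_bind]
    grw [hall]
    split
    · simp only [steps_bind, steps_step]
      grw [hA, ih _ (max_le hg (hI i).1)]
      omega
    · simp only [steps_bind, steps_step]
      grw [hend]
      split
      · simp only [steps_bind]
        grw [hth, ih']
        omega
      · grw [ih']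
        omega

theorem steps_insertTask (I : Inst n) (i : Fin n) (l : List (Fin n)) :
    (insertTask I i l).steps ≤ 4 * l.length + 1 := by
  induction l with
  | nil => simp [insertTask]
  | cons j l ih =>
    simp only [insertTask, steps_bind, steps_step, List.length_cons]
    split
    · simp only [steps_step]; omega
    · simp only [steps_bind, steps_step]
      omega

theorem steps_sortTasks (I : Inst n) (l : List (Fin n)) :
    (sortTasks I l).steps ≤ l.length * (4 * l.length + 1) + 1 := by
  induction l with
  | nil => simp [sortTasks]
  | cons i l ih =>
    simp only [sortTasks, steps_bind]
    grw [ih, steps_insertTask]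
    rw [(sortTasks_perm I l).length_eq, List.length_cons]
    nlinarith

theorem steps_greedyRLM (I : Inst n) (ρ : SearchOrder n) {d k : ℕ}
    (hI : ∀ i, (I.T i).d ≤ d ∧ (I.T i).k ≤ k) :
    (greedyRLM I ρ).steps ≤ n * d + (n * (4 * n + 1) + 1) + n * passSteps n d k := by
  have h1 : ∑ i, (I.T i).d ≤ n * d :=
    (sum_le_sum fun i _ => (hI i).1).trans (by simp)
  have h2 := steps_sortTasks I (List.finRange n)
  have h3 := steps_greedyLoop I ρ hI (sortTasks I (List.finRange n)).val
    { y := fun _ _ => 0, accepted := ∅, th := 0, c := 0, c' := 0 } (Nat.zero_le d)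
  rw [(sortTasks_perm I _).length_eq, List.length_finRange] at h3
  rw [List.length_finRange] at h2
  have h4 : (initAlloc I).steps ≤ n * d := h1
  have h5 : (initAlloc I).val = fun _ _ => 0 := rfl
  simp only [greedyRLM, steps_bind, steps_pure, h5]
  omega

theorem slotSteps_le {n : ℕ} (hn : 0 < n) (d k : ℕ) : slotSteps n d k ≤ slotSteps 1 d k * n := by
  unfold slotSteps
  have h1 : d * (2 * n + 5) + 5 * n + 20 ≤ (d * (2 * 1 + 5) + 5 * 1 + 20) * n := by
    nlinarith [Nat.mul_le_mul_left d hn]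
  have h2 := Nat.mul_le_mul_left k h1
  nlinarith [Nat.mul_le_mul_left d hn]

theorem passSteps_le {n : ℕ} (hn : 0 < n) (d k : ℕ) : passSteps n d k ≤ passSteps 1 d k * n := by
  unfold passSteps
  have h1 := Nat.mul_le_mul_left d (slotSteps_le hn d k)
  nlinarith [Nat.mul_le_mul_left d hn]

theorem steps_greedyRLM_le_sq (hn : 0 < n) (I : Inst n) (ρ : SearchOrder n) {d k : ℕ}
    (hI : ∀ i, (I.T i).d ≤ d ∧ (I.T i).k ≤ k) :
    (greedyRLM I ρ).steps ≤ (d + 6 + passSteps 1 d k) * n ^ 2 := by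
  have h1 := Nat.mul_le_mul_left n (passSteps_le hn d k)
  have h2 : n ≤ n * n := Nat.le_mul_of_pos_left n hn
  have h3 := Nat.mul_le_mul_right d h2
  refine (steps_greedyRLM I ρ hI).trans ?_
  nlinarith

end Malleable

theorem proposition3 :
    (∀ (n : ℕ), 0 < n → ∀ (I : Malleable.Inst n), I.Valid → ∀ (ρ : Malleable.SearchOrder n),
      I.Feasible (Malleable.greedyRLM I ρ).val.1 (Malleable.greedyRLM I ρ).val.2 ∧
      (I.minSlackness - 1) / I.minSlackness * I.optWelfare
        ≤ I.welfare (Malleable.greedyRLM I ρ).val.1) ∧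
    (∀ (dmax kmax : ℕ), ∃ c : ℕ, ∀ (n : ℕ), 0 < n → ∀ (I : Malleable.Inst n), I.Valid →
      (∀ i, (I.T i).d ≤ dmax ∧ (I.T i).k ≤ kmax) → ∀ (ρ : Malleable.SearchOrder n),
      (Malleable.greedyRLM I ρ).steps ≤ c * n ^ 2) :=
  ⟨fun _ hn I hI ρ => Malleable.greedyRLM_correct hn I hI ρ,
    fun dmax kmax => ⟨dmax + 6 + Malleable.passSteps 1 dmax kmax,
      fun _ hn I _ hb ρ => Malleable.steps_greedyRLM_le_sq hn I ρ hb⟩⟩
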